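/- Let $k\ge 3$ be a fixed integer. For $n\ge 0$, colour each edge of the complete graph $K_n$ red or blue, all $2^{\binom n2}$ colourings being equally likely. Let $X$ be the number of $k$-element vertex sets $S$ such that all edges of $K_n$ inside $S$ have the same colour (the number of monochromatic $K_k$), and let $\mu=E[X]$. Then, for each $m\in\{2,3,4,5\}$, the central moment $E[(X-\mu)^m]$ is a polynomial function of $n$ (a single real polynomial, depending on $k$ and $m$, gives its value for every integer $n\ge 0$), and the leading terms of these polynomials in $n$ are as follows. The leading term of $E[(X-\mu)^2]$ is $$\frac12\cdot\frac{1}{(k-3)!^2}\cdot\frac{n^{2k-3}}{2^{2\binom k2-2}}.$$ The leading term of $E[(X-\mu)^3]$ is $$\frac{1}{(k-3)!^3}\cdot\frac{n^{3k-5}}{2^{3\binom k2-3}}.$$ The leading term of $E[(X-\mu)^4]$ is $$\frac34\cdot\frac{1}{(k-3)!^4}\cdot\frac{n^{4k-6}}{2^{4\binom k2-4}}.$$ The leading term of $E[(X-\mu)^5]$ is $$5\cdot\frac{1}{(k-3)!^5}\cdot\frac{n^{5k-8}}{2^{5\binom k2-5}}.$$ -/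

import Mathlib

open SimpleGraph MeasureTheory ProbabilityTheory

/-- Two-colourings of the edges of the complete graph `K_n` on the vertex set `Fin n`. -/
abbrev TwoColouring (n : ℕ) : Type := TopEdgeLabeling (Fin n) Bool

/-- The set of colourings is finite; every set of colourings is an event. -/
instance TwoColouring.instMeasurableSpace (n : ℕ) : MeasurableSpace (TwoColouring n) := ⊤

instance TwoColouring.instDiscreteMeasurableSpace (n : ℕ) :
    DiscreteMeasurableSpace (TwoColouring n) := ⟨fun _ => trivial⟩

/-- The law of a uniformly random two-colouring of the edges of `K_n`. -/
noncomputable def uniformColouring (n : ℕ) : Measure (TwoColouring n) :=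
  uniformOn (Set.univ : Set (TwoColouring n))

/-- The subgraph of `K_n` induced by `S` is monochromatic: all its edges have the same colour. -/
def IsMonochromatic {n : ℕ} (C : TwoColouring n) (S : Finset (Fin n)) : Prop :=
  ∃ c : Bool, ∀ x ∈ S, ∀ y ∈ S, ∀ h : x ≠ y, EdgeLabeling.get C x y h = c

open Classical in
/-- The number `X` of monochromatic `K_k` in the colouring `C`, that is, the sum over all
`k`-subsets `S` of the vertex set of the indicator that `S` induces a monochromatic subgraph. -/
noncomputable def monoCliqueCount (k n : ℕ) (C : TwoColouring n) : ℝ :=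
  ∑ S ∈ Finset.powersetCard k (Finset.univ : Finset (Fin n)), if IsMonochromatic C S then 1 else 0

/-- `E[(X - μ)^m]` for the number `X` of monochromatic `K_k` in a uniformly random two-colouring
of the edges of `K_n`, where `μ = E[X]`. -/
noncomputable def monoCentralMoment (k m n : ℕ) : ℝ :=
  centralMoment (monoCliqueCount k n) m (uniformColouring n)

/-- `f` is a polynomial function of `n ∈ ℕ`, and the leading term of this polynomial
is `c * n ^ d`. -/
def HasLeadingTerm (f : ℕ → ℝ) (c : ℝ) (d : ℕ) : Prop :=
  ∃ P : Polynomial ℝ, (∀ n : ℕ, f n = P.eval (n : ℝ)) ∧ P.natDegree = d ∧ P.leadingCoeff = c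

/-! Give every edge the sign `1` or `-1` of its colour. Up to the factor `2 ^ k.choose 2`, the
indicator that a `k`-set is monochromatic is the product of `1 + sign` over its edges plus the
product of `1 - sign`. On expansion the odd edge sets cancel and the even ones double. So `X - μ` is
`2 / 2 ^ k.choose 2` times a sum over nonempty even edge sets `G` of the character of `G`, weighted
by the number of `k`-sets containing the support of `G` (`monoCliqueCount_eq`). Characters are
orthogonal, hence the `m`-th central moment is a sum of products of weights over `m`-tuples of even
sets in which each edge occurs an even number of times (`monoCentralMoment_eq`).

A support of `v ≤ k` vertices has weight of degree `k - v` in `n`, and a tuple whose supports span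
`u` vertices can be placed in order `n ^ u` ways. A type of tuple with support sizes `v i` thus
contributes degree `m * k - (∑ v i - u)` (`exists_polynomial_sum_cliqueWeight`), and the leading
term comes from the least excess `∑ v i - u`. Each vertex lies in at least two supports and each `v
i` is at least 3, so the excess is at least `3 * m / 2`, that is 3, 5, 6, 8 for `m = 2, 3, 4, 5`.

An even set on three vertices is a two-edge path. The extremal tuples are one path taken twice (`3 *
n.choose 3` of them), the three paths in a star with three edges (`24 * n.choose 4`), two equal
pairs, and an equal pair together with a star. The last two types are not counted directly:
`coverSum_four_eq` and `coverSum_five_eq` split off products of smaller cover sums, with 3 and 10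
choices of a pair of indices, and leave a coefficient that vanishes on extremal tuples. This gives
`3 * (1/2) ^ 2 = 3/4` and `10 * (1/2) * 1 = 5`. -/

/-- If a sum exceeds the obvious lower bound by one, then exactly one summand does so. -/
lemma exists_eq_add_one_of_sum_eq {α : Type*} {s : Finset α} {f : α → ℕ} {c : ℕ}
    (hc : ∀ x ∈ s, c ≤ f x) (h : ∑ x ∈ s, f x = c * s.card + 1) :
    ∃ x₀ ∈ s, f x₀ = c + 1 ∧ ∀ x ∈ s, x ≠ x₀ → f x = c := by
  classical
  have h1 : ∑ x ∈ s, (f x - c) = 1 := by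
    have h2 : ∑ x ∈ s, f x = ∑ x ∈ s, ((f x - c) + c) :=
      Finset.sum_congr rfl fun x hx => (Nat.sub_add_cancel (hc x hx)).symm
    rw [h2, Finset.sum_add_distrib, Finset.sum_const, smul_eq_mul, mul_comm c] at h
    omega
  obtain ⟨x₀, hx₀, hne⟩ := Finset.exists_ne_zero_of_sum_ne_zero (h1.trans_ne one_ne_zero)
  rw [← Finset.add_sum_erase _ _ hx₀] at h1
  refine ⟨x₀, hx₀, by omega, fun x hx hxx => ?_⟩
  have h3 : ∑ x ∈ s.erase x₀, (f x - c) = 0 := by omega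
  have h4 := Finset.sum_eq_zero_iff.1 h3 x (Finset.mem_erase.2 ⟨hxx, hx⟩)
  have h5 := hc x hx
  omega

/-! ### Even edge sets, even covers and vertex degrees in a cover. -/

section EdgeSets

variable {V : Type*}

/-- A nonempty set of an even number of edges, none of which is a loop. -/
structure IsEvenEdgeSet (G : Finset (Sym2 V)) : Prop where
  not_isDiag : ∀ e ∈ G, ¬ e.IsDiag
  nonempty : G.Nonempty
  even_card : Even G.card

lemma IsEvenEdgeSet.two_le_card {G : Finset (Sym2 V)} (h : IsEvenEdgeSet G) : 2 ≤ G.card := by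
  have h1 := h.nonempty.card_pos
  obtain ⟨r, hr⟩ := h.even_card
  omega

variable [DecidableEq V]

/-- The set of endpoints of the edges in `G`. -/
def vertexSupport (G : Finset (Sym2 V)) : Finset V := G.biUnion Sym2.toFinset

lemma mem_vertexSupport {G : Finset (Sym2 V)} {x : V} :
    x ∈ vertexSupport G ↔ ∃ e ∈ G, x ∈ e := by
  simp [vertexSupport]

lemma vertexSupport_mono {G H : Finset (Sym2 V)} (h : G ⊆ H) :
    vertexSupport G ⊆ vertexSupport H :=
  Finset.biUnion_subset_biUnion_of_subset_left _ h

lemma IsEvenEdgeSet.subset_image_offDiag {G : Finset (Sym2 V)} (h : IsEvenEdgeSet G) :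
    G ⊆ (vertexSupport G).offDiag.image Sym2.mk.uncurry := by
  intro e he
  induction e with
  | _ x y =>
    have hxy : x ≠ y := by simpa using h.not_isDiag _ he
    refine Finset.mem_image.2 ⟨(x, y), ?_, rfl⟩
    simp only [Finset.mem_offDiag, mem_vertexSupport]
    exact ⟨⟨_, he, by simp⟩, ⟨_, he, by simp⟩, hxy⟩

lemma IsEvenEdgeSet.card_le {G : Finset (Sym2 V)} (h : IsEvenEdgeSet G) :
    G.card ≤ (vertexSupport G).card.choose 2 := by
  rw [← Sym2.card_image_offDiag]
  exact Finset.card_le_card h.subset_image_offDiag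

lemma IsEvenEdgeSet.three_le_card_vertexSupport {G : Finset (Sym2 V)} (h : IsEvenEdgeSet G) :
    3 ≤ (vertexSupport G).card := by
  by_contra! hlt
  have h1 := h.card_le
  have h2 := h.two_le_card
  have h3 : (vertexSupport G).card.choose 2 ≤ Nat.choose 2 2 := Nat.choose_le_choose 2 (by omega)
  simp at h3
  omega

/-- Three vertices carry at most three edges, and parity rules out the triangle. -/
lemma IsEvenEdgeSet.card_eq_two {G : Finset (Sym2 V)} (h : IsEvenEdgeSet G)
    (h3 : (vertexSupport G).card = 3) : G.card = 2 := by
  have h1 := h.card_le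
  have h2 := h.two_le_card
  obtain ⟨r, hr⟩ := h.even_card
  rw [h3, show Nat.choose 3 2 = 3 from rfl] at h1
  omega

/-- An even edge set on three vertices is a path with two edges. -/
lemma IsEvenEdgeSet.exists_eq_path {G : Finset (Sym2 V)} (h : IsEvenEdgeSet G)
    (h3 : (vertexSupport G).card = 3) :
    ∃ w a b, w ≠ a ∧ w ≠ b ∧ a ≠ b ∧ G = {s(w, a), s(w, b)} := by
  obtain ⟨x, y, z, hxy, hxz, hyz, hS⟩ := Finset.card_eq_three.1 h3
  have hsub : G ⊆ {s(x, y), s(x, z), s(y, z)} := by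
    intro e he
    have h1 := h.subset_image_offDiag he
    rw [hS] at h1
    simp only [Finset.mem_image, Finset.mem_offDiag, Prod.exists, Finset.mem_insert,
      Finset.mem_singleton] at h1 ⊢
    obtain ⟨a, b, ⟨ha, hb, hab⟩, rfl⟩ := h1
    rcases ha with rfl | rfl | rfl <;> rcases hb with rfl | rfl | rfl <;>
      simp_all [Sym2.eq_swap]
  have h2 := h.card_eq_two h3
  obtain ⟨e, f, hef, rfl⟩ := Finset.card_eq_two.1 h2
  have he := hsub (Finset.mem_insert_self _ _)
  have hf := hsub (Finset.mem_insert_of_mem (Finset.mem_singleton_self _))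
  simp only [Finset.mem_insert, Finset.mem_singleton] at he hf
  rcases he with rfl | rfl | rfl <;> rcases hf with rfl | rfl | rfl
  · exact absurd rfl hef
  · exact ⟨x, y, z, hxy, hxz, hyz, rfl⟩
  · exact ⟨y, x, z, hxy.symm, hyz, hxz, by rw [Sym2.eq_swap]⟩
  · exact ⟨x, z, y, hxz, hxy, hyz.symm, rfl⟩
  · exact absurd rfl hef
  · exact ⟨z, x, y, hxz.symm, hyz.symm, hxy, by rw [Sym2.eq_swap, @Sym2.eq_swap _ y z]⟩
  · exact ⟨y, z, x, hyz, hxy.symm, hxz.symm, by rw [@Sym2.eq_swap _ y x]⟩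
  · exact ⟨z, y, x, hyz.symm, hxz.symm, hxy.symm, by rw [Sym2.eq_swap, @Sym2.eq_swap _ x z]⟩
  · exact absurd rfl hef

lemma vertexSupport_path (w a b : V) : vertexSupport {s(w, a), s(w, b)} = {w, a, b} := by
  ext x
  simp only [mem_vertexSupport, Finset.mem_insert, Finset.mem_singleton]
  constructor
  · rintro ⟨e, rfl | rfl, h⟩ <;> simp at h <;> tauto
  · rintro (rfl | rfl | rfl)
    · exact ⟨s(x, a), by simp, by simp⟩
    · exact ⟨s(w, x), by simp, by simp⟩
    · exact ⟨s(w, x), by simp, by simp⟩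

lemma isEvenEdgeSet_path {w a b : V} (hwa : w ≠ a) (hwb : w ≠ b) (hab : a ≠ b) :
    IsEvenEdgeSet ({s(w, a), s(w, b)} : Finset (Sym2 V)) where
  not_isDiag e he := by
    simp only [Finset.mem_insert, Finset.mem_singleton] at he
    rcases he with rfl | rfl <;> simpa
  nonempty := by simp
  even_card := by
    rw [Finset.card_pair (by simp [hab, hwb])]
    exact even_two

lemma card_vertexSupport_path {w a b : V} (hwa : w ≠ a) (hwb : w ≠ b) (hab : a ≠ b) :
    (vertexSupport ({s(w, a), s(w, b)} : Finset (Sym2 V))).card = 3 := by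
  rw [vertexSupport_path]
  exact Finset.card_eq_three.2 ⟨w, a, b, hwa, hwb, hab, rfl⟩

lemma IsEvenEdgeSet.eq_of_subset {G H : Finset (Sym2 V)} (hG : IsEvenEdgeSet G)
    (hH : IsEvenEdgeSet H) (hG3 : (vertexSupport G).card = 3) (hH3 : (vertexSupport H).card = 3)
    (h : G ⊆ H) : G = H :=
  Finset.eq_of_subset_of_card_le h (by rw [hG.card_eq_two hG3, hH.card_eq_two hH3])

variable {ι : Type*} [Fintype ι]

/-- Every edge belongs to an even number of the sets `F i`. -/
def EvenCover (F : ι → Finset (Sym2 V)) : Prop :=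
  ∀ e, Even (Finset.univ.filter fun i => e ∈ F i).card

/-- The set of endpoints of the edges in all the sets `F i`. -/
def unionSupport (F : ι → Finset (Sym2 V)) : Finset V :=
  Finset.univ.biUnion fun i => vertexSupport (F i)

/-- The number of indices `i` such that `x` is an endpoint of an edge in `F i`. -/
def coverDegree (F : ι → Finset (Sym2 V)) (x : V) : ℕ :=
  (Finset.univ.filter fun i => x ∈ vertexSupport (F i)).card

lemma mem_unionSupport {F : ι → Finset (Sym2 V)} {x : V} :
    x ∈ unionSupport F ↔ ∃ i, x ∈ vertexSupport (F i) := by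
  simp [unionSupport]

lemma sum_card_vertexSupport (F : ι → Finset (Sym2 V)) :
    ∑ i, (vertexSupport (F i)).card = ∑ x ∈ unionSupport F, coverDegree F x := by
  have h := Finset.sum_card_bipartiteAbove_eq_sum_card_bipartiteBelow
    (s := (Finset.univ : Finset ι)) (t := unionSupport F) (fun i x => x ∈ vertexSupport (F i))
  refine (Finset.sum_congr rfl fun i _ => ?_).trans h
  congr 1
  ext x
  simp only [Finset.bipartiteAbove, Finset.mem_filter, mem_unionSupport]
  exact ⟨fun hx => ⟨⟨i, hx⟩, hx⟩, fun hx => hx.2⟩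

lemma EvenCover.exists_ne_mem {F : ι → Finset (Sym2 V)} (hF : EvenCover F) {i : ι} {e : Sym2 V}
    (he : e ∈ F i) : ∃ j, j ≠ i ∧ e ∈ F j := by
  classical
  by_contra! h
  have h1 : (Finset.univ.filter fun j => e ∈ F j) = {i} := by
    ext j
    simp only [Finset.mem_filter, Finset.mem_univ, true_and, Finset.mem_singleton]
    exact ⟨fun hj => by_contra fun hne => h j hne hj, fun hj => hj ▸ he⟩
  have := hF e
  rw [h1] at this
  simp at this

lemma EvenCover.two_le_coverDegree {F : ι → Finset (Sym2 V)} (hF : EvenCover F) {x : V}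
    (hx : x ∈ unionSupport F) : 2 ≤ coverDegree F x := by
  classical
  obtain ⟨i, hi⟩ := mem_unionSupport.1 hx
  obtain ⟨e, he, hxe⟩ := mem_vertexSupport.1 hi
  obtain ⟨j, hji, hj⟩ := hF.exists_ne_mem he
  rw [coverDegree, ← Finset.card_pair hji]
  refine Finset.card_le_card fun l hl => ?_
  simp only [Finset.mem_insert, Finset.mem_singleton] at hl
  simp only [Finset.mem_filter, Finset.mem_univ, true_and, mem_vertexSupport]
  rcases hl with rfl | rfl
  · exact ⟨e, hj, hxe⟩
  · exact ⟨e, he, hxe⟩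

/-- Double counting of incidences between vertices and supports. Together with the bound 3 on each
support size, this inequality yields all the degree bounds. -/
lemma EvenCover.two_mul_card_unionSupport_le {F : ι → Finset (Sym2 V)} (hF : EvenCover F) :
    2 * (unionSupport F).card ≤ ∑ i, (vertexSupport (F i)).card := by
  rw [sum_card_vertexSupport, mul_comm, ← smul_eq_mul]
  exact Finset.card_nsmul_le_sum _ _ _ fun x hx => hF.two_le_coverDegree hx

/-- Vertices of degree two in the cover lie in no third support. -/
lemma eq_of_coverDegree_eq_two {F : ι → Finset (Sym2 V)} {x : V} (hx : coverDegree F x = 2)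
    {i j l : ι} (hij : i ≠ j) (hi : x ∈ vertexSupport (F i)) (hj : x ∈ vertexSupport (F j))
    (hl : x ∈ vertexSupport (F l)) : l = i ∨ l = j := by
  classical
  by_contra! h
  have h1 : ({l, i, j} : Finset ι) ⊆ Finset.univ.filter fun i => x ∈ vertexSupport (F i) := by
    intro t ht
    simp only [Finset.mem_insert, Finset.mem_singleton] at ht
    rcases ht with rfl | rfl | rfl <;> simpa
  have h2 := Finset.card_le_card h1
  rw [Finset.card_eq_three.2 ⟨l, i, j, h.1, h.2, hij, rfl⟩] at h2
  rw [coverDegree] at hx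
  omega

/-- A two-edge path whose centre has degree two is contained in another member of the cover. -/
lemma EvenCover.exists_subset {F : ι → Finset (Sym2 V)} (hF : EvenCover F) {i : ι} {w a b : V}
    (hi : F i = {s(w, a), s(w, b)}) (hw : coverDegree F w = 2) : ∃ j, j ≠ i ∧ F i ⊆ F j := by
  have ha : s(w, a) ∈ F i := by simp [hi]
  have hb : s(w, b) ∈ F i := by simp [hi]
  obtain ⟨j, hji, hj⟩ := hF.exists_ne_mem ha
  obtain ⟨l, hli, hl⟩ := hF.exists_ne_mem hb
  -- The centre lies in only one further support, so the second copies of both edges lie in the same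
  -- set.
  have hlj : l = j := by
    have := eq_of_coverDegree_eq_two hw hji.symm (mem_vertexSupport.2 ⟨_, ha, by simp⟩)
      (mem_vertexSupport.2 ⟨_, hj, by simp⟩) (mem_vertexSupport.2 ⟨_, hl, by simp⟩)
    tauto
  subst hlj
  refine ⟨l, hli, fun e he => ?_⟩
  rw [hi] at he
  simp only [Finset.mem_insert, Finset.mem_singleton] at he
  rcases he with rfl | rfl <;> assumption

/-- A vertex of the cover has degree two if the sum of the sizes of the supports is minimal. -/
lemma EvenCover.coverDegree_eq_two {F : ι → Finset (Sym2 V)} (hF : EvenCover F)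
    (h : ∑ i, (vertexSupport (F i)).card = 2 * (unionSupport F).card) {x : V}
    (hx : x ∈ unionSupport F) : coverDegree F x = 2 := by
  rw [sum_card_vertexSupport, mul_comm, ← smul_eq_mul, ← Finset.sum_const] at h
  exact ((Finset.sum_eq_sum_iff_of_le fun x hx => hF.two_le_coverDegree hx).1 h.symm x hx).symm

/-- If the sum of the sizes of the supports exceeds the minimum by one, then all vertices but one
have degree two, and that one has degree three. -/
lemma EvenCover.exists_coverDegree_eq_three {F : ι → Finset (Sym2 V)} (hF : EvenCover F)
    (h : ∑ i, (vertexSupport (F i)).card = 2 * (unionSupport F).card + 1) :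
    ∃ x₀, coverDegree F x₀ = 3 ∧ ∀ x ∈ unionSupport F, x ≠ x₀ → coverDegree F x = 2 := by
  rw [sum_card_vertexSupport] at h
  obtain ⟨x₀, -, h3, h2⟩ := exists_eq_add_one_of_sum_eq
    (fun x hx => hF.two_le_coverDegree hx) h
  exact ⟨x₀, h3, h2⟩

/-- If all vertices have degree two, then not all supports but one can have three elements while
the exceptional one has four. -/
lemma EvenCover.not_all_three_but_one {F : ι → Finset (Sym2 V)} (hF : EvenCover F)
    (hG : ∀ i, IsEvenEdgeSet (F i)) (h2 : ∀ x ∈ unionSupport F, coverDegree F x = 2) {q : ι}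
    (hq : (vertexSupport (F q)).card = 4)
    (h3 : ∀ i, i ≠ q → (vertexSupport (F i)).card = 3) : False := by
  classical
  -- An edge of `F q` at `x` recurs in some path `F i`. That path is contained in another member,
  -- and since `x` has degree two this member can only be `F q`.
  have key : ∀ x ∈ vertexSupport (F q), ∃ i, i ≠ q ∧ x ∈ vertexSupport (F i) ∧ F i ⊆ F q := by
    intro x hx
    obtain ⟨e, he, hxe⟩ := mem_vertexSupport.1 hx
    obtain ⟨i, hiq, hi⟩ := hF.exists_ne_mem he
    have hxi : x ∈ vertexSupport (F i) := mem_vertexSupport.2 ⟨e, hi, hxe⟩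
    obtain ⟨w, a, b, hwa, hwb, hab, hp⟩ := (hG i).exists_eq_path (h3 i hiq)
    have hw : w ∈ vertexSupport (F i) := by rw [hp, vertexSupport_path]; simp
    obtain ⟨j, hji, hj⟩ := hF.exists_subset hp (h2 w (mem_unionSupport.2 ⟨i, hw⟩))
    have hjq := eq_of_coverDegree_eq_two (h2 x (mem_unionSupport.2 ⟨q, hx⟩)) hiq hxi hx
      (vertexSupport_mono hj hxi)
    obtain rfl : j = q := by tauto
    exact ⟨i, hiq, hxi, hj⟩
  obtain ⟨x, hx⟩ : (vertexSupport (F q)).Nonempty := Finset.card_pos.1 (by omega)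
  obtain ⟨i, hiq, hxi, hi⟩ := key x hx
  obtain ⟨y, hy, hyi⟩ := Finset.exists_mem_notMem_of_card_lt_card
    (s := vertexSupport (F i)) (t := vertexSupport (F q)) (by rw [h3 i hiq, hq]; norm_num)
  obtain ⟨l, hlq, hyl, hl⟩ := key y hy
  have hil : i ≠ l := by
    rintro rfl
    exact hyi hyl
  -- A common vertex of the two paths would lie in a third support, that of `F q`. Two disjoint
  -- triples do not fit into four vertices.
  have hdisj : Disjoint (vertexSupport (F i)) (vertexSupport (F l)) := by
    rw [Finset.disjoint_left]
    intro z hzi hzl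
    have := eq_of_coverDegree_eq_two (h2 z (mem_unionSupport.2 ⟨i, hzi⟩)) hil hzi hzl
      (vertexSupport_mono hi hzi)
    tauto
  have h6 := Finset.card_le_card (Finset.union_subset (vertexSupport_mono hi)
    (vertexSupport_mono hl))
  rw [Finset.card_union_of_disjoint hdisj, h3 i hiq, h3 l hlq, hq] at h6
  omega

end EdgeSets

/-! ### Extremal even covers by two, three, four and five sets. -/

section SmallCovers

variable {V : Type*} [DecidableEq V]

section

variable {ι : Type*} [Fintype ι] {F : ι → Finset (Sym2 V)}

/-- Even sets on three vertices all have two edges, so the inclusion of `EvenCover.exists_subset` is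
an equality. -/
lemma EvenCover.exists_eq (hF : EvenCover F) (hG : ∀ i, IsEvenEdgeSet (F i))
    (h3 : ∀ i, (vertexSupport (F i)).card = 3) {i : ι} {w a b : V}
    (hi : F i = {s(w, a), s(w, b)}) (hw : coverDegree F w = 2) : ∃ j, j ≠ i ∧ F i = F j := by
  obtain ⟨j, hji, hj⟩ := hF.exists_subset hi hw
  exact ⟨j, hji, (hG i).eq_of_subset (hG j) (h3 i) (h3 j) hj⟩

lemma three_le_coverDegree {i j l : ι} (hij : i ≠ j) (hil : i ≠ l) (hjl : j ≠ l)
    (h1 : F i = F j) (h2 : F i = F l) {x : V} (hx : x ∈ vertexSupport (F i)) :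
    3 ≤ coverDegree F x := by
  classical
  rw [← Finset.card_eq_three.2 ⟨i, j, l, hij, hil, hjl, rfl⟩, coverDegree]
  refine Finset.card_le_card fun t ht => ?_
  simp only [Finset.mem_insert, Finset.mem_singleton] at ht
  simp only [Finset.mem_filter, Finset.mem_univ, true_and]
  rcases ht with rfl | rfl | rfl
  · exact hx
  · rwa [← h1]
  · rwa [← h2]

end

lemma EvenCover.fin_two_eq {F : Fin 2 → Finset (Sym2 V)} (hF : EvenCover F) : F 0 = F 1 := by
  have h : ∀ i j : Fin 2, i ≠ j → F i ⊆ F j := by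
    intro i j hij e he
    obtain ⟨l, hl, hel⟩ := hF.exists_ne_mem he
    obtain rfl : l = j := by omega
    exact hel
  exact (h 0 1 (by decide)).antisymm (h 1 0 (by decide))

lemma evenCover_fin_two_iff {F : Fin 2 → Finset (Sym2 V)} : EvenCover F ↔ F 0 = F 1 := by
  refine ⟨fun h => h.fin_two_eq, fun h e => ?_⟩
  rw [Finset.card_filter, Fin.sum_univ_two, h]
  exact Even.add_self _

lemma EvenCover.fin_two_excess {F : Fin 2 → Finset (Sym2 V)} (hF : EvenCover F)
    (hG : ∀ i, IsEvenEdgeSet (F i)) (h3 : (vertexSupport (F 0)).card ≠ 3) :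
    (unionSupport F).card + 4 ≤ ∑ i, (vertexSupport (F i)).card := by
  have h1 := hF.two_mul_card_unionSupport_le
  have h2 := (hG 0).three_le_card_vertexSupport
  rw [Fin.sum_univ_two, ← hF.fin_two_eq] at h1 ⊢
  omega

/-- The three two-edge paths in a star with three edges. -/
def IsStarCover (F : Fin 3 → Finset (Sym2 V)) : Prop :=
  ∃ w a b c, w ≠ a ∧ w ≠ b ∧ w ≠ c ∧ a ≠ b ∧ a ≠ c ∧ b ≠ c ∧
    F 0 = {s(w, a), s(w, b)} ∧ F 1 = {s(w, b), s(w, c)} ∧ F 2 = {s(w, a), s(w, c)}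

/-- Two equal sets cancel modulo two, which would leave the edges of the third, nonempty set covered
an odd number of times. -/
lemma EvenCover.fin_three_ne {F : Fin 3 → Finset (Sym2 V)} (hF : EvenCover F)
    (hG : ∀ i, IsEvenEdgeSet (F i)) {i j : Fin 3} (hij : i ≠ j) : F i ≠ F j := by
  intro h
  obtain ⟨l, -, hl⟩ := Finset.exists_mem_notMem_of_card_lt_card
    (s := ({i, j} : Finset (Fin 3))) (t := Finset.univ) (by simp [Finset.card_pair hij])
  simp only [Finset.mem_insert, Finset.mem_singleton, not_or] at hl
  have hu : ({i, j, l} : Finset (Fin 3)) = Finset.univ :=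
    Finset.eq_univ_of_card _ (Finset.card_eq_three.2 ⟨i, j, l, hij, Ne.symm hl.1, Ne.symm hl.2, rfl⟩)
  obtain ⟨e, he⟩ := (hG l).nonempty
  have h1 := hF e
  rw [Finset.card_filter, ← hu, Finset.sum_insert (by simp [hij, Ne.symm hl.1]),
    Finset.sum_insert (by simp [Ne.symm hl.2]), Finset.sum_singleton, h, if_pos he,
    Nat.even_iff] at h1
  split_ifs at h1

lemma IsEvenEdgeSet.exists_of_mem {G : Finset (Sym2 V)} (hG : IsEvenEdgeSet G)
    {w a b x : V} (hp : G = {s(w, a), s(w, b)}) (hx : s(w, x) ∈ G) :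
    ∃ c, G = {s(w, x), s(w, c)} := by
  subst hp
  simp only [Finset.mem_insert, Finset.mem_singleton, Sym2.congr_right] at hx
  rcases hx with rfl | rfl
  · exact ⟨b, rfl⟩
  · exact ⟨a, Finset.pair_comm _ _⟩

lemma EvenCover.fin_three_isStarCover {F : Fin 3 → Finset (Sym2 V)} (hF : EvenCover F)
    (hG : ∀ i, IsEvenEdgeSet (F i))
    (h : ∑ i, (vertexSupport (F i)).card ≤ (unionSupport F).card + 5) : IsStarCover F := by
  have h1 := hF.two_mul_card_unionSupport_le
  have h3 := fun i => (hG i).three_le_card_vertexSupport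
  have h9 : 9 ≤ ∑ i, (vertexSupport (F i)).card := by
    have := h3 0
    have := h3 1
    have := h3 2
    rw [Fin.sum_univ_three]
    omega
  -- The bounds `2 * u ≤ ∑ v i ≤ u + 5` give `u ≤ 5`. The total 10 forces `u = 5` and all degrees
  -- two; the total 9 forces `u = 4` and a single vertex of degree three.
  obtain hs | hs : ∑ i, (vertexSupport (F i)).card = 10 ∨
      ∑ i, (vertexSupport (F i)).card = 9 := by omega
  · obtain ⟨q, -, hq, hq'⟩ := exists_eq_add_one_of_sum_eq (s := Finset.univ) (c := 3)
      (fun i _ => h3 i) (by simpa using hs)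
    exact (hF.not_all_three_but_one hG
      (fun x hx => hF.coverDegree_eq_two (by omega) hx) hq
      (fun i hi => hq' i (Finset.mem_univ _) hi)).elim
  have hv : ∀ i, (vertexSupport (F i)).card = 3 := by
    have h0 := h3 0
    have h1 := h3 1
    have h2 := h3 2
    rw [Fin.sum_univ_three] at hs
    intro i
    fin_cases i <;> simp only [Fin.zero_eta, Fin.mk_one, Fin.reduceFinMk] <;> omega
  obtain ⟨w, -, hw⟩ := hF.exists_coverDegree_eq_three (by omega)
  have hc : ∀ i, ∃ a b, w ≠ a ∧ w ≠ b ∧ a ≠ b ∧ F i = {s(w, a), s(w, b)} := by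
    intro i
    obtain ⟨x, a, b, hxa, hxb, hab, hp⟩ := (hG i).exists_eq_path (hv i)
    -- A path centred elsewhere has a centre of degree two, hence equals another member, which is
    -- impossible for three sets.
    obtain rfl : x = w := by
      by_contra hxw
      obtain ⟨j, hji, hj⟩ := hF.exists_eq hG hv hp (hw x (mem_unionSupport.2 ⟨i, by
        rw [hp, vertexSupport_path]; simp⟩) hxw)
      exact hF.fin_three_ne hG hji.symm hj
    exact ⟨a, b, hxa, hxb, hab, hp⟩
  have hpar : ∀ e, e ∈ F 0 → (e ∈ F 1 ↔ e ∉ F 2) := by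
    intro e he
    have := hF e
    rw [Finset.card_filter, Fin.sum_univ_three, if_pos he] at this
    by_cases h1 : e ∈ F 1 <;> by_cases h2 : e ∈ F 2 <;> simp_all [Nat.even_iff]
  have hpar' : ∀ e, e ∉ F 0 → (e ∈ F 1 ↔ e ∈ F 2) := by
    intro e he
    have := hF e
    rw [Finset.card_filter, Fin.sum_univ_three, if_neg he] at this
    by_cases h1 : e ∈ F 1 <;> by_cases h2 : e ∈ F 2 <;> simp_all [Nat.even_iff]
  have hne : ∀ (i : Fin 3) (x : V), s(w, x) ∈ F i → w ≠ x := by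
    intro i x hx
    simpa using (hG i).not_isDiag _ hx
  have main : ∀ a b, w ≠ a → w ≠ b → a ≠ b → F 0 = {s(w, a), s(w, b)} → s(w, b) ∈ F 1 →
      IsStarCover F := by
    intro a b hwa hwb hab h0 hb1
    have ha1 : s(w, a) ∉ F 1 := by
      intro ha1
      refine hF.fin_three_ne hG (i := 0) (j := 1) (by decide)
        ((hG 0).eq_of_subset (hG 1) (hv 0) (hv 1) ?_)
      rw [h0]
      intro e he
      simp only [Finset.mem_insert, Finset.mem_singleton] at he
      rcases he with rfl | rfl <;> assumption
    have ha2 : s(w, a) ∈ F 2 := by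
      by_contra hn
      exact ha1 ((hpar _ (by simp [h0])).2 hn)
    obtain ⟨a1, b1, -, -, -, hp1⟩ := hc 1
    obtain ⟨c, hc1⟩ := (hG 1).exists_of_mem hp1 hb1
    have hc1m : s(w, c) ∈ F 1 := by simp [hc1]
    have hac : a ≠ c := by
      rintro rfl
      exact ha1 hc1m
    have hbc : b ≠ c := by
      rintro rfl
      have := (hG 1).card_eq_two (hv 1)
      rw [hc1] at this
      simp at this
    have hwc := hne 1 c hc1m
    have hc0 : s(w, c) ∉ F 0 := by
      simp only [h0, Finset.mem_insert, Finset.mem_singleton, Sym2.congr_right, not_or]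
      exact ⟨hac.symm, hbc.symm⟩
    have hc2 : s(w, c) ∈ F 2 := (hpar' _ hc0).1 hc1m
    refine ⟨w, a, b, c, hwa, hwb, hwc, hab, hac, hbc, h0, hc1, ?_⟩
    symm
    refine (isEvenEdgeSet_path hwa hwc hac).eq_of_subset (hG 2)
      (card_vertexSupport_path hwa hwc hac) (hv 2) fun e he => ?_
    simp only [Finset.mem_insert, Finset.mem_singleton] at he
    rcases he with rfl | rfl <;> assumption
  obtain ⟨a, b, hwa, hwb, hab, h0⟩ := hc 0
  -- By parity each edge of `F 0` lies in exactly one of `F 1` and `F 2`. Were both edges in `F 2`,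
  -- it would equal `F 0`; so one of them lies in `F 1`, and the situation is symmetric in `a` and
  -- `b`.
  by_cases hb : s(w, b) ∈ F 1
  · exact main a b hwa hwb hab h0 hb
  · refine main b a hwb hwa hab.symm (by rw [h0, Finset.pair_comm]) ?_
    by_contra ha
    have hb2 : s(w, b) ∈ F 2 := by
      by_contra hn
      exact hb ((hpar _ (by simp [h0])).2 hn)
    have ha2 : s(w, a) ∈ F 2 := by
      by_contra hn
      exact ha ((hpar _ (by simp [h0])).2 hn)
    refine hF.fin_three_ne hG (i := 0) (j := 2) (by decide)
      ((hG 0).eq_of_subset (hG 2) (hv 0) (hv 2) fun e he => ?_)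
    simp only [h0, Finset.mem_insert, Finset.mem_singleton] at he
    rcases he with rfl | rfl <;> assumption

lemma IsStarCover.isEvenEdgeSet {F : Fin 3 → Finset (Sym2 V)} (h : IsStarCover F) (i : Fin 3) :
    IsEvenEdgeSet (F i) := by
  obtain ⟨w, a, b, c, hwa, hwb, hwc, hab, hac, hbc, h0, h1, h2⟩ := h
  match i with
  | 0 => rw [h0]; exact isEvenEdgeSet_path hwa hwb hab
  | 1 => rw [h1]; exact isEvenEdgeSet_path hwb hwc hbc
  | 2 => rw [h2]; exact isEvenEdgeSet_path hwa hwc hac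

lemma IsStarCover.card_vertexSupport {F : Fin 3 → Finset (Sym2 V)} (h : IsStarCover F)
    (i : Fin 3) : (vertexSupport (F i)).card = 3 := by
  obtain ⟨w, a, b, c, hwa, hwb, hwc, hab, hac, hbc, h0, h1, h2⟩ := h
  match i with
  | 0 => rw [h0]; exact card_vertexSupport_path hwa hwb hab
  | 1 => rw [h1]; exact card_vertexSupport_path hwb hwc hbc
  | 2 => rw [h2]; exact card_vertexSupport_path hwa hwc hac

lemma IsStarCover.evenCover {F : Fin 3 → Finset (Sym2 V)} (h : IsStarCover F) : EvenCover F := by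
  obtain ⟨w, a, b, c, hwa, hwb, hwc, hab, hac, hbc, h0, h1, h2⟩ := h
  intro e
  rw [Finset.card_filter, Fin.sum_univ_three, h0, h1, h2]
  simp only [Finset.mem_insert, Finset.mem_singleton]
  by_cases ha : e = s(w, a)
  · simp [ha, hab, hac, hwa.symm]
  by_cases hb : e = s(w, b)
  · simp [hb, hab.symm, hbc, hwb.symm]
  by_cases hc : e = s(w, c) <;>
    simp [ha, hb, hc, hac.symm, hbc.symm, hwc.symm]

lemma IsStarCover.card_unionSupport {F : Fin 3 → Finset (Sym2 V)} (h : IsStarCover F) :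
    (unionSupport F).card = 4 := by
  obtain ⟨w, a, b, c, hwa, hwb, hwc, hab, hac, hbc, h0, h1, h2⟩ := h
  have : unionSupport F = {w, a, b, c} := by
    ext x
    rw [mem_unionSupport, Fin.exists_fin_succ, Fin.exists_fin_succ, Fin.exists_fin_one]
    simp only [Fin.succ_zero_eq_one, Fin.succ_one_eq_two]
    rw [h0, h1, h2]
    simp only [vertexSupport_path, Finset.mem_insert, Finset.mem_singleton]
    tauto
  rw [this]
  rw [Finset.card_insert_of_notMem (by simp [hwa, hwb, hwc]),
    Finset.card_eq_three.2 ⟨a, b, c, hab, hac, hbc, rfl⟩]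

/-- The star covers are the even covers by three even edge sets of largest support. -/
lemma isStarCover_iff {F : Fin 3 → Finset (Sym2 V)} :
    IsStarCover F ↔ (EvenCover F ∧ ∀ i, IsEvenEdgeSet (F i)) ∧
      ∑ i, (vertexSupport (F i)).card ≤ (unionSupport F).card + 5 := by
  refine ⟨fun h => ⟨⟨h.evenCover, h.isEvenEdgeSet⟩, ?_⟩,
    fun h => h.1.1.fin_three_isStarCover h.1.2 h.2⟩
  simp [h.card_unionSupport, h.card_vertexSupport]

/-- In an even cover by four even edge sets of largest support, exactly one of the other sets
equals the first one. -/
lemma EvenCover.fin_four_card_eq_one {F : Fin 4 → Finset (Sym2 V)} (hF : EvenCover F)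
    (hG : ∀ i, IsEvenEdgeSet (F i))
    (h : ∑ i, (vertexSupport (F i)).card ≤ (unionSupport F).card + 6) :
    (Finset.univ.filter fun j => j ≠ 0 ∧ F 0 = F j).card = 1 := by
  have h1 := hF.two_mul_card_unionSupport_le
  have h3 := fun i => (hG i).three_le_card_vertexSupport
  have h30 := h3 0
  have h31 := h3 1
  have h32 := h3 2
  have h33 := h3 3
  have hv : ∀ i, (vertexSupport (F i)).card = 3 := by
    rw [Fin.sum_univ_four] at h h1
    intro i
    fin_cases i <;> simp only [Fin.zero_eta, Fin.mk_one, Fin.reduceFinMk] <;> omega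
  have hd : ∀ x ∈ unionSupport F, coverDegree F x = 2 := by
    refine fun x hx => hF.coverDegree_eq_two ?_ hx
    simp only [hv, Finset.sum_const, Finset.card_univ, Fintype.card_fin, smul_eq_mul] at h h1 ⊢
    omega
  obtain ⟨w, a, b, hwa, hwb, hab, hp⟩ := (hG 0).exists_eq_path (hv 0)
  have hw : w ∈ vertexSupport (F 0) := by rw [hp, vertexSupport_path]; simp
  have hdw := hd w (mem_unionSupport.2 ⟨0, hw⟩)
  obtain ⟨j, hj0, hj⟩ := hF.exists_eq hG hv hp hdw
  refine Finset.card_eq_one.2 ⟨j, ?_⟩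
  ext l
  simp only [Finset.mem_filter, Finset.mem_univ, true_and, Finset.mem_singleton]
  constructor
  · rintro ⟨hl0, hl⟩
    by_contra hlj
    have := three_le_coverDegree hj0.symm hl0.symm (Ne.symm hlj) hj hl hw
    omega
  · rintro rfl
    exact ⟨hj0, hj⟩

/-- Both pairs cancel modulo two, leaving the fifth set uncovered. -/
lemma EvenCover.fin_five_not_two_pairs {F : Fin 5 → Finset (Sym2 V)} (hF : EvenCover F)
    (hG : ∀ i, IsEvenEdgeSet (F i)) {i j p q : Fin 5} (hij : i ≠ j) (hip : i ≠ p) (hiq : i ≠ q)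
    (hjp : j ≠ p) (hjq : j ≠ q) (hpq : p ≠ q) (h1 : F i = F j) (h2 : F p = F q) : False := by
  have h4 : ({i, j, p, q} : Finset (Fin 5)).card = 4 := by
    rw [Finset.card_insert_of_notMem (by simp [hij, hip, hiq]),
      Finset.card_eq_three.2 ⟨j, p, q, hjp, hjq, hpq, rfl⟩]
  obtain ⟨l, -, hl⟩ := Finset.exists_mem_notMem_of_card_lt_card
    (s := ({i, j, p, q} : Finset (Fin 5))) (t := Finset.univ) (by simp [h4])
  have hu : insert l ({i, j, p, q} : Finset (Fin 5)) = Finset.univ :=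
    Finset.eq_univ_of_card _ (by rw [Finset.card_insert_of_notMem hl, h4, Fintype.card_fin])
  obtain ⟨e, he⟩ := (hG l).nonempty
  have h := hF e
  rw [Finset.card_filter, ← hu, Finset.sum_insert hl,
    Finset.sum_insert (by simp [hij, hip, hiq]), Finset.sum_insert (by simp [hjp, hjq]),
    Finset.sum_insert (by simp [hpq]), Finset.sum_singleton, h1, h2, if_pos he, Nat.even_iff] at h
  split_ifs at h

/-- In an even cover by five even edge sets of largest support, there is exactly one pair of equal
sets. -/
lemma EvenCover.fin_five_card_eq_one {F : Fin 5 → Finset (Sym2 V)} (hF : EvenCover F)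
    (hG : ∀ i, IsEvenEdgeSet (F i))
    (h : ∑ i, (vertexSupport (F i)).card ≤ (unionSupport F).card + 8) :
    (Finset.univ.filter fun p : Fin 5 × Fin 5 => p.1 < p.2 ∧ F p.1 = F p.2).card = 1 := by
  have h1 := hF.two_mul_card_unionSupport_le
  have h3 := fun i => (hG i).three_le_card_vertexSupport
  have h30 := h3 0
  have h31 := h3 1
  have h32 := h3 2
  have h33 := h3 3
  have h34 := h3 4
  obtain hs | hs : ∑ i, (vertexSupport (F i)).card = 16 ∨
      ∑ i, (vertexSupport (F i)).card = 15 := by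
    rw [Fin.sum_univ_five] at *
    omega
  · obtain ⟨q, -, hq, hq'⟩ := exists_eq_add_one_of_sum_eq (s := Finset.univ) (c := 3)
      (fun i _ => h3 i) (by simpa using hs)
    exact (hF.not_all_three_but_one hG
      (fun x hx => hF.coverDegree_eq_two (by omega) hx) hq
      (fun i hi => hq' i (Finset.mem_univ _) hi)).elim
  have hv : ∀ i, (vertexSupport (F i)).card = 3 := by
    rw [Fin.sum_univ_five] at hs
    intro i
    fin_cases i <;> simp only [Fin.zero_eta, Fin.mk_one, Fin.reduceFinMk] <;> omega
  obtain ⟨w, hw3, hw⟩ := hF.exists_coverDegree_eq_three (by omega)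
  -- Three equal sets give every vertex of their support degree at least three, but only `w` has
  -- such a degree.
  have htriple : ∀ i j l : Fin 5, i ≠ j → i ≠ l → j ≠ l → F i = F j → F i = F l → False := by
    intro i j l hij hil hjl hj hl
    obtain ⟨x, hx, hxw⟩ := Finset.exists_mem_ne (s := vertexSupport (F i))
      (by rw [hv i]; norm_num) w
    have h2 := hw x (mem_unionSupport.2 ⟨i, hx⟩) hxw
    have := three_le_coverDegree hij hil hjl hj hl hx
    omega
  -- Only three of the five supports contain `w`. A path avoiding `w` has a centre of degree two and
  -- so coincides with another member.
  obtain ⟨i, j, hij, heq⟩ : ∃ i j : Fin 5, i < j ∧ F i = F j := by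
    obtain ⟨i, -, hi⟩ := Finset.exists_mem_notMem_of_card_lt_card
      (s := Finset.univ.filter fun i => w ∈ vertexSupport (F i)) (t := Finset.univ)
      (by rw [← coverDegree, hw3]; simp)
    simp only [Finset.mem_filter, Finset.mem_univ, true_and] at hi
    obtain ⟨x, a, b, hxa, hxb, hab, hp⟩ := (hG i).exists_eq_path (hv i)
    have hx : x ∈ vertexSupport (F i) := by rw [hp, vertexSupport_path]; simp
    obtain ⟨j, hji, hj⟩ := hF.exists_eq hG hv hp
      (hw x (mem_unionSupport.2 ⟨i, hx⟩) (fun hxw => hi (hxw ▸ hx)))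
    rcases lt_or_gt_of_ne hji with hlt | hlt
    · exact ⟨j, i, hlt, hj.symm⟩
    · exact ⟨i, j, hlt, hj⟩
  refine Finset.card_eq_one.2 ⟨(i, j), ?_⟩
  ext ⟨p, q⟩
  simp only [Finset.mem_filter, Finset.mem_univ, true_and, Finset.mem_singleton, Prod.mk.injEq]
  constructor
  · rintro ⟨hpq, hpq'⟩
    by_cases hip : i = p
    · subst hip
      by_contra hne
      exact htriple i j q hij.ne hpq.ne (fun hjq => hne ⟨rfl, hjq.symm⟩) heq hpq'
    by_cases hiq : i = q
    · subst hiq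
      exact (htriple i j p hij.ne hpq.ne' (hpq.trans hij).ne' heq hpq'.symm).elim
    by_cases hjp : j = p
    · subst hjp
      exact (htriple j i q hij.ne' hpq.ne (hij.trans hpq).ne heq.symm hpq').elim
    by_cases hjq : j = q
    · subst hjq
      exact (htriple j i p hij.ne' hpq.ne' hip heq.symm hpq'.symm).elim
    exact (hF.fin_five_not_two_pairs hG hij.ne hip hiq hjp hjq hpq.ne heq hpq').elim
  · rintro ⟨rfl, rfl⟩
    exact ⟨hij, heq⟩

end SmallCovers

/-! ### Invariance under embeddings of the vertex set. -/

section Relabelling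

variable {V W : Type*} {ι : Type*}

/-- The family of edge sets obtained by applying an embedding to all vertices. -/
def relabel (f : V ↪ W) (F : ι → Finset (Sym2 V)) : ι → Finset (Sym2 W) :=
  fun i => (F i).map f.sym2Map

lemma relabel_injective (f : V ↪ W) :
    Function.Injective (relabel f : (ι → Finset (Sym2 V)) → ι → Finset (Sym2 W)) :=
  fun _ _ h => funext fun i => Finset.map_injective f.sym2Map (congrFun h i)

lemma relabel_apply_eq_iff (f : V ↪ W) {F : ι → Finset (Sym2 V)} {i j : ι} :
    relabel f F i = relabel f F j ↔ F i = F j :=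
  (Finset.map_injective f.sym2Map).eq_iff

lemma isEvenEdgeSet_map_iff (f : V ↪ W) {G : Finset (Sym2 V)} :
    IsEvenEdgeSet (G.map f.sym2Map) ↔ IsEvenEdgeSet G := by
  have hdiag : (∀ e ∈ G.map f.sym2Map, ¬ e.IsDiag) ↔ ∀ e ∈ G, ¬ e.IsDiag := by
    simp only [Finset.mem_map, forall_exists_index, and_imp, forall_apply_eq_imp_iff₂]
    refine forall₂_congr fun e _ => not_congr ?_
    exact Sym2.isDiag_map f.injective
  constructor
  · rintro ⟨h1, h2, h3⟩
    exact ⟨hdiag.1 h1, Finset.map_nonempty.1 h2, by rwa [Finset.card_map] at h3⟩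
  · rintro ⟨h1, h2, h3⟩
    exact ⟨hdiag.2 h1, Finset.map_nonempty.2 h2, by rwa [Finset.card_map]⟩

variable [DecidableEq V] [DecidableEq W]

lemma vertexSupport_map (f : V ↪ W) (G : Finset (Sym2 V)) :
    vertexSupport (G.map f.sym2Map) = (vertexSupport G).map f := by
  ext x
  simp only [mem_vertexSupport, Finset.mem_map, Function.Embedding.sym2Map_apply]
  constructor
  · rintro ⟨_, ⟨e, he, rfl⟩, hx⟩
    obtain ⟨y, hy, rfl⟩ := Sym2.mem_map.1 hx
    exact ⟨y, ⟨e, he, hy⟩, rfl⟩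
  · rintro ⟨y, ⟨e, he, hy⟩, rfl⟩
    exact ⟨_, ⟨e, he, rfl⟩, Sym2.mem_map.2 ⟨y, hy, rfl⟩⟩

lemma card_vertexSupport_relabel (f : V ↪ W) (F : ι → Finset (Sym2 V)) (i : ι) :
    (vertexSupport (relabel f F i)).card = (vertexSupport (F i)).card := by
  rw [relabel, vertexSupport_map, Finset.card_map]

variable [Fintype ι]

lemma unionSupport_relabel (f : V ↪ W) (F : ι → Finset (Sym2 V)) :
    unionSupport (relabel f F) = (unionSupport F).map f := by
  ext x
  simp only [mem_unionSupport, relabel, vertexSupport_map, Finset.mem_map]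
  tauto

lemma evenCover_relabel_iff (f : V ↪ W) {F : ι → Finset (Sym2 V)} :
    EvenCover (relabel f F) ↔ EvenCover F := by
  constructor
  · intro h e
    have := h (f.sym2Map e)
    simpa only [relabel, Finset.mem_map'] using this
  · intro h e
    by_cases he : ∃ e', f.sym2Map e' = e
    · obtain ⟨e', rfl⟩ := he
      simpa only [relabel, Finset.mem_map'] using h e'
    · have : (Finset.univ.filter fun i => e ∈ relabel f F i) = ∅ := by
        refine Finset.filter_eq_empty_iff.2 fun i _ hi => he ?_
        obtain ⟨e', -, h'⟩ := Finset.mem_map.1 hi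
        exact ⟨e', h'⟩
      rw [this]
      simp

end Relabelling

lemma exists_relabel_eq {V W ι : Type*} [DecidableEq W] [Fintype ι] (f : V ↪ W) {F : ι → Finset (Sym2 W)}
    (h : ∀ x ∈ unionSupport F, x ∈ Set.range f) : ∃ G : ι → Finset (Sym2 V), relabel f G = F := by
  have hF : ∀ i, ∃ G : Finset (Sym2 V), G.map f.sym2Map = F i := by
    intro i
    refine ⟨(F i).preimage f.sym2Map f.sym2Map.injective.injOn, ?_⟩
    ext e
    simp only [Finset.mem_map, Finset.mem_preimage]
    constructor
    · rintro ⟨e, he, rfl⟩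
      exact he
    · intro he
      induction e with
      | _ x y =>
        obtain ⟨a, rfl⟩ := h x (mem_unionSupport.2 ⟨i, mem_vertexSupport.2 ⟨_, he, by simp⟩⟩)
        obtain ⟨b, rfl⟩ := h y (mem_unionSupport.2 ⟨i, mem_vertexSupport.2 ⟨_, he, by simp⟩⟩)
        exact ⟨s(a, b), he, rfl⟩
  choose G hG using hF
  exact ⟨G, funext hG⟩

/-! ### Polynomiality in the number of vertices. -/

section Polynomials

open Polynomial

/-- The polynomial in `n` with values `(n - v).choose j` for `n ≥ v`. -/
noncomputable def chooseSubPoly (j v : ℕ) : ℝ[X] :=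
  C (1 / (j.factorial : ℝ)) * (descPochhammer ℝ j).comp (X - C (v : ℝ))

lemma chooseSubPoly_eval {j v n : ℕ} (h : v ≤ n) :
    (chooseSubPoly j v).eval (n : ℝ) = ((n - v).choose j : ℝ) := by
  rw [chooseSubPoly, eval_mul, eval_C, eval_comp, eval_sub, eval_X, eval_C, ← Nat.cast_sub h,
    descPochhammer_eval_eq_descFactorial, Nat.descFactorial_eq_factorial_mul_choose]
  push_cast
  field_simp

lemma chooseSubPoly_natDegree (j v : ℕ) : (chooseSubPoly j v).natDegree = j := by
  rw [chooseSubPoly, natDegree_C_mul (by positivity), natDegree_comp, natDegree_X_sub_C, mul_one,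
    descPochhammer_natDegree]

lemma chooseSubPoly_leadingCoeff (j v : ℕ) :
    (chooseSubPoly j v).leadingCoeff = 1 / (j.factorial : ℝ) := by
  rw [chooseSubPoly, leadingCoeff_mul, leadingCoeff_C,
    ((monic_descPochhammer ℝ j).comp_X_sub_C _).leadingCoeff, mul_one]

/-- The number of `k`-subsets of an `n`-set that contain a given `v`-subset. -/
noncomputable def cliqueWeight (k n v : ℕ) : ℝ :=
  if v ≤ k then ((n - v).choose (k - v) : ℝ) else 0

/-- The sum over all `m`-tuples of edge sets, with coefficients that do not change under
relabelling, of the number of ways to extend the supports to `k`-sets is a polynomial in the number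
of vertices. -/
theorem exists_polynomial_sum_cliqueWeight {m k D : ℕ}
    (c : ∀ n, (Fin m → Finset (Sym2 (Fin n))) → ℝ)
    (hinv : ∀ {u n : ℕ} (f : Fin u ↪ Fin n) (F : Fin m → Finset (Sym2 (Fin u))),
      c n (relabel f F) = c u F)
    (hdeg : ∀ (u : ℕ) (F : Fin m → Finset (Sym2 (Fin u))), c u F ≠ 0 →
      (∀ i, (vertexSupport (F i)).card ≤ k) →
      (unionSupport F).card + ∑ i, (k - (vertexSupport (F i)).card) ≤ D) :
    ∃ P : ℝ[X], P.natDegree ≤ D ∧ ∀ n : ℕ,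
      ∑ F : Fin m → Finset (Sym2 (Fin n)),
        c n F * ∏ i, cliqueWeight k n (vertexSupport (F i)).card = P.eval (n : ℝ) := by
  classical
  let A : ℕ → ℕ → ℝ := fun u n =>
    ∑ F : Fin m → Finset (Sym2 (Fin u)) with unionSupport F = Finset.univ,
      c u F * ∏ i, cliqueWeight k n (vertexSupport (F i)).card
  let P : ℕ → ℝ[X] := fun u => chooseSubPoly u 0 *
    ∑ F : Fin m → Finset (Sym2 (Fin u)) with unionSupport F = Finset.univ,
      if ∀ i, (vertexSupport (F i)).card ≤ k then
        C (c u F) * ∏ i, chooseSubPoly (k - (vertexSupport (F i)).card) (vertexSupport (F i)).card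
      else 0
  have hA : ∀ n : ℕ, ∑ F : Fin m → Finset (Sym2 (Fin n)),
      c n F * ∏ i, cliqueWeight k n (vertexSupport (F i)).card =
      ∑ u ∈ Finset.range (n + 1), (n.choose u : ℝ) * A u n := by
    intro n
    -- Tuples are grouped by the union of their supports; by invariance, the contribution of a union
    -- depends only on its size.
    rw [← Finset.sum_fiberwise Finset.univ unionSupport]
    have h1 : ∀ U : Finset (Fin n), ∑ F : Fin m → Finset (Sym2 (Fin n)) with unionSupport F = U,
        c n F * ∏ i, cliqueWeight k n (vertexSupport (F i)).card = A U.card n := by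
      intro U
      let f : Fin U.card ↪ Fin n := (U.orderEmbOfFin rfl).toEmbedding
      have hf : Finset.univ.map f = U := by
        simp [f]
      symm
      refine Finset.sum_bij (fun F _ => relabel f F) ?_ ?_ ?_ ?_
      · intro F hF
        simp only [Finset.mem_filter, Finset.mem_univ, true_and] at hF ⊢
        rw [unionSupport_relabel, hF, hf]
      · intro F _ G _ h
        exact relabel_injective f h
      · intro F hF
        simp only [Finset.mem_filter, Finset.mem_univ, true_and] at hF
        obtain ⟨G, rfl⟩ := exists_relabel_eq f (F := F) (by
          intro x hx
          rw [hF, ← hf] at hx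
          simpa using hx)
        refine ⟨G, ?_, rfl⟩
        simp only [Finset.mem_filter, Finset.mem_univ, true_and]
        rw [unionSupport_relabel] at hF
        exact Finset.map_injective f (hF.trans hf.symm)
      · intro F _
        rw [hinv]
        simp only [card_vertexSupport_relabel]
    rw [Finset.sum_congr rfl fun U _ => h1 U, ← Finset.powerset_univ,
      Finset.sum_powerset_apply_card (fun u => A u n)]
    simp
  have hA0 : ∀ u n, D < u → A u n = 0 := by
    intro u n hu
    refine Finset.sum_eq_zero fun F hF => ?_
    simp only [Finset.mem_filter, Finset.mem_univ, true_and] at hF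
    by_cases hc : c u F = 0
    · rw [hc, zero_mul]
    by_cases hk : ∀ i, (vertexSupport (F i)).card ≤ k
    · have := hdeg u F hc hk
      rw [hF, Finset.card_univ, Fintype.card_fin] at this
      omega
    · push Not at hk
      obtain ⟨i, hi⟩ := hk
      rw [Finset.prod_eq_zero (Finset.mem_univ i), mul_zero]
      rw [cliqueWeight, if_neg (by omega)]
  have hP : ∀ u n : ℕ, (P u).eval (n : ℝ) = (n.choose u : ℝ) * A u n := by
    intro u n
    simp only [P, A]
    rw [eval_mul, chooseSubPoly_eval (Nat.zero_le n), Nat.sub_zero]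
    -- `chooseSubPoly` has the intended value only for `v ≤ n`. If `n < u`, the factor `n.choose u`
    -- vanishes; otherwise `v ≤ u ≤ n`.
    rcases lt_or_ge n u with hlt | hle
    · rw [Nat.choose_eq_zero_of_lt hlt]
      simp
    congr 1
    rw [eval_finsetSum]
    refine Finset.sum_congr rfl fun F _ => ?_
    split_ifs with hk
    · rw [eval_mul, eval_C, eval_prod]
      congr 1
      refine Finset.prod_congr rfl fun i _ => ?_
      rw [chooseSubPoly_eval, cliqueWeight, if_pos (hk i)]
      refine le_trans ?_ hle
      simpa using Finset.card_le_univ (vertexSupport (F i))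
    · push Not at hk
      obtain ⟨i, hi⟩ := hk
      rw [Finset.prod_eq_zero (Finset.mem_univ i), mul_zero, eval_zero]
      rw [cliqueWeight, if_neg (by omega)]
  have hPdeg : ∀ u, (P u).natDegree ≤ D := by
    intro u
    have hterm : ∀ F ∈ (Finset.univ.filter fun F : Fin m → Finset (Sym2 (Fin u)) =>
        unionSupport F = Finset.univ),
        (chooseSubPoly u 0 * if ∀ i, (vertexSupport (F i)).card ≤ k then
          C (c u F) * ∏ i, chooseSubPoly (k - (vertexSupport (F i)).card)
            (vertexSupport (F i)).card
        else 0).natDegree ≤ D := by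
      intro F hF
      simp only [Finset.mem_filter, Finset.mem_univ, true_and] at hF
      split_ifs with hk
      · by_cases hc : c u F = 0
        · simp [hc]
        refine le_trans ?_ (hdeg u F hc hk)
        refine natDegree_mul_le.trans ?_
        rw [chooseSubPoly_natDegree, hF, Finset.card_univ, Fintype.card_fin]
        gcongr
        refine (natDegree_C_mul_le _ _).trans ((natDegree_prod_le _ _).trans ?_)
        simp [chooseSubPoly_natDegree]
      · simp
    simp only [P, Finset.mul_sum]
    exact natDegree_sum_le_of_forall_le _ _ hterm
  refine ⟨∑ u ∈ Finset.range (D + 1), P u, ?_, fun n => ?_⟩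
  · exact natDegree_sum_le_of_forall_le _ _ fun u _ => hPdeg u
  · rw [hA n, eval_finsetSum, Finset.sum_congr rfl fun u _ => hP u n]
    -- The range up to `n` must be traded for one independent of `n`. Terms with `n < u` vanish by
    -- the binomial coefficient and terms with `D < u` by `hA0`, so both ranges extend to a common
    -- one.
    have h1 : ∑ u ∈ Finset.range (n + 1), (n.choose u : ℝ) * A u n =
        ∑ u ∈ Finset.range (n + D + 1), (n.choose u : ℝ) * A u n := by
      refine Finset.sum_subset (Finset.range_subset_range.2 (by omega)) fun u _ hu => ?_
      rw [Nat.choose_eq_zero_of_lt (by simpa using hu)]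
      simp
    have h2 : ∑ u ∈ Finset.range (D + 1), (n.choose u : ℝ) * A u n =
        ∑ u ∈ Finset.range (n + D + 1), (n.choose u : ℝ) * A u n := by
      refine Finset.sum_subset (Finset.range_subset_range.2 (by omega)) fun u _ hu => ?_
      rw [hA0 u n (by simpa using hu), mul_zero]
    rw [h1, h2]

end Polynomials

/-! ### Fourier expansion of the clique count and its central moments. -/

section Expectation

variable {n : ℕ}

lemma integral_uniformColouring (f : TwoColouring n → ℝ) :
    ∫ C, f C ∂(uniformColouring n) = (∑ C, f C) / Fintype.card (TwoColouring n) := by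
  have hprob : IsProbabilityMeasure (uniformColouring n) :=
    isProbabilityMeasure_uniformOn Set.finite_univ Set.univ_nonempty
  rw [integral_fintype .of_finite, Finset.sum_div]
  refine Finset.sum_congr rfl fun C _ => ?_
  rw [Measure.real, uniformColouring, uniformOn_univ, Measure.count_singleton]
  simp [div_eq_inv_mul]

/-- The sign of the edge `e` in the colouring `C`; loops have sign `1`. -/
noncomputable def edgeSign (C : TwoColouring n) (e : Sym2 (Fin n)) : ℝ :=
  if h : e ∈ (⊤ : SimpleGraph (Fin n)).edgeSet then (if C ⟨e, h⟩ then 1 else -1) else 1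

/-- The product of the signs of the edges in `G`. -/
noncomputable def character (C : TwoColouring n) (G : Finset (Sym2 (Fin n))) : ℝ :=
  ∏ e ∈ G, edgeSign C e

/-- Collecting the factors edge by edge turns a product of characters into a product over
independent coordinates; loops have sign 1 and drop out. -/
lemma prod_character {ι : Type*} [Fintype ι] (C : TwoColouring n) (F : ι → Finset (Sym2 (Fin n))) :
    ∏ i, character C (F i) =
      ∏ e : (⊤ : SimpleGraph (Fin n)).edgeSet,
        (if C e then (1 : ℝ) else -1) ^
          (Finset.univ.filter fun i => (e : Sym2 (Fin n)) ∈ F i).card := by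
  have h1 : ∀ i, character C (F i) = ∏ e : Sym2 (Fin n), if e ∈ F i then edgeSign C e else 1 := by
    intro i
    rw [character, Finset.prod_ite_mem, Finset.univ_inter]
  rw [Finset.prod_congr rfl fun i _ => h1 i, Finset.prod_comm]
  have h2 : ∀ e : Sym2 (Fin n), ∏ i, (if e ∈ F i then edgeSign C e else 1) =
      edgeSign C e ^ (Finset.univ.filter fun i => e ∈ F i).card := by
    intro e
    rw [← Finset.prod_filter, Finset.prod_const]
  rw [Finset.prod_congr rfl fun e _ => h2 e]
  symm
  refine Fintype.prod_of_injective Subtype.val Subtype.val_injective _ _ ?_ ?_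
  · intro e he
    have : edgeSign C e = 1 := dif_neg (by simpa using he)
    rw [this, one_pow]
  · intro e
    rw [edgeSign, dif_pos e.2]

open Classical in
/-- The characters are orthogonal. -/
lemma sum_prod_character {ι : Type*} [Fintype ι] {F : ι → Finset (Sym2 (Fin n))}
    (hF : ∀ i, IsEvenEdgeSet (F i)) :
    ∑ C : TwoColouring n, ∏ i, character C (F i) =
      if EvenCover F then (Fintype.card (TwoColouring n) : ℝ) else 0 := by
  have h1 : ∑ C : TwoColouring n, ∏ i, character C (F i) =
      ∏ e : (⊤ : SimpleGraph (Fin n)).edgeSet, ∑ b : Bool, (if b then (1 : ℝ) else -1) ^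
        (Finset.univ.filter fun i => (e : Sym2 (Fin n)) ∈ F i).card := by
    rw [Finset.prod_univ_sum, Fintype.piFinset_univ]
    exact Finset.sum_congr rfl fun C _ => prod_character C F
  have h2 : ∀ d : ℕ, ∑ b : Bool, (if b then (1 : ℝ) else -1) ^ d = if Even d then 2 else 0 := by
    intro d
    rw [Fintype.sum_bool]
    by_cases hd : Even d
    · simp [hd, hd.neg_one_pow]
      norm_num
    · simp [hd, (Nat.not_even_iff_odd.1 hd).neg_one_pow]
  rw [h1, Finset.prod_congr rfl fun e _ => h2 _]
  split_ifs with hE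
  · rw [Finset.prod_congr rfl fun e _ => if_pos (hE e.1), Finset.prod_const, Finset.card_univ]
    have : Fintype.card (TwoColouring n) =
        2 ^ Fintype.card (⊤ : SimpleGraph (Fin n)).edgeSet := by
      rw [← Fintype.card_bool, ← Fintype.card_fun]
      exact Fintype.card_congr (Equiv.refl _)
    rw [this]
    push_cast
    rfl
  · rw [EvenCover] at hE
    push Not at hE
    obtain ⟨e, he⟩ := hE
    -- Loops are not coordinates of a colouring. An odd multiplicity is positive, so `e` lies in
    -- some `F i` and is not a loop.
    have hedge : e ∈ (⊤ : SimpleGraph (Fin n)).edgeSet := by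
      obtain ⟨i, hi⟩ := Finset.card_pos.1 (Nat.not_even_iff_odd.1 he).pos
      simpa using (hF i).not_isDiag e (by simpa using hi)
    exact Finset.prod_eq_zero (Finset.mem_univ ⟨e, hedge⟩) (if_neg he)

lemma edgeSign_mk (C : TwoColouring n) {x y : Fin n} (h : x ≠ y) :
    edgeSign C s(x, y) = if EdgeLabeling.get C x y h then 1 else -1 := by
  rw [edgeSign, dif_pos (by simpa using h)]
  rfl

lemma edgeSign_eq_one_or (C : TwoColouring n) (e : Sym2 (Fin n)) :
    edgeSign C e = 1 ∨ edgeSign C e = -1 := by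
  rw [edgeSign]
  split_ifs <;> simp

/-- The edges of the complete graph on the vertex set `S`. -/
def edgesIn (S : Finset (Fin n)) : Finset (Sym2 (Fin n)) := S.offDiag.image Sym2.mk.uncurry

lemma card_edgesIn (S : Finset (Fin n)) : (edgesIn S).card = S.card.choose 2 :=
  Sym2.card_image_offDiag S

lemma forall_mem_edgesIn {S : Finset (Fin n)} {p : Sym2 (Fin n) → Prop} :
    (∀ e ∈ edgesIn S, p e) ↔ ∀ x ∈ S, ∀ y ∈ S, x ≠ y → p s(x, y) := by
  simp only [edgesIn, Finset.mem_image, Finset.mem_offDiag, Prod.exists]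
  constructor
  · intro h x hx y hy hxy
    exact h _ ⟨x, y, ⟨hx, hy, hxy⟩, rfl⟩
  · rintro h _ ⟨x, y, ⟨hx, hy, hxy⟩, rfl⟩
    exact h x hx y hy hxy

lemma isMonochromatic_iff (C : TwoColouring n) (S : Finset (Fin n)) :
    IsMonochromatic C S ↔
      (∀ e ∈ edgesIn S, edgeSign C e = 1) ∨ ∀ e ∈ edgesIn S, edgeSign C e = -1 := by
  rw [IsMonochromatic, Bool.exists_bool, or_comm, forall_mem_edgesIn, forall_mem_edgesIn]
  have h1 : ∀ b : Bool, (if b then (1 : ℝ) else -1) = 1 ↔ b = true := by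
    intro b; cases b <;> norm_num
  have h2 : ∀ b : Bool, (if b then (1 : ℝ) else -1) = -1 ↔ b = false := by
    intro b; cases b <;> norm_num
  refine or_congr ?_ ?_
  · refine forall₂_congr fun x _ => forall₂_congr fun y _ => forall_congr' fun h => ?_
    rw [edgeSign_mk C h, h1]
  · refine forall₂_congr fun x _ => forall₂_congr fun y _ => forall_congr' fun h => ?_
    rw [edgeSign_mk C h, h2]

lemma prod_one_add_of_sign {α : Type*} {s : Finset α} {f : α → ℝ}
    (hf : ∀ x ∈ s, f x = 1 ∨ f x = -1) [Decidable (∀ x ∈ s, f x = 1)] :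
    ∏ x ∈ s, (1 + f x) = if ∀ x ∈ s, f x = 1 then 2 ^ s.card else 0 := by
  split_ifs with h
  · rw [← Finset.prod_const]
    refine Finset.prod_congr rfl fun x hx => ?_
    rw [h x hx]
    norm_num
  · push Not at h
    obtain ⟨x, hx, hne⟩ := h
    refine Finset.prod_eq_zero hx ?_
    rw [(hf x hx).resolve_left hne]
    norm_num

open Classical in
-- Each product detects one colour, being `2 ^ S.card.choose 2` if all signs agree with it and 0
-- otherwise. Two vertices are needed so that an edge exists and the two colours exclude each other.
lemma indicator_isMonochromatic_mul (C : TwoColouring n) {S : Finset (Fin n)} (hS : 2 ≤ S.card) :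
    (if IsMonochromatic C S then (1 : ℝ) else 0) * 2 ^ S.card.choose 2 =
      ∏ e ∈ edgesIn S, (1 + edgeSign C e) + ∏ e ∈ edgesIn S, (1 + -edgeSign C e) := by
  have hne : (edgesIn S).Nonempty := by
    rw [← Finset.card_pos, card_edgesIn]
    exact Nat.choose_pos hS
  obtain ⟨e₀, he₀⟩ := hne
  rw [prod_one_add_of_sign fun e _ => edgeSign_eq_one_or C e,
    prod_one_add_of_sign fun e _ => by
      rcases edgeSign_eq_one_or C e with h | h <;> simp [h], isMonochromatic_iff, card_edgesIn]
  simp only [neg_eq_iff_eq_neg]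
  by_cases h1 : ∀ e ∈ edgesIn S, edgeSign C e = 1
  · have h2 : ¬ ∀ e ∈ edgesIn S, edgeSign C e = -1 := by
      intro h2
      have := (h1 _ he₀).symm.trans (h2 _ he₀)
      norm_num at this
    simp [if_pos h1, if_neg h2, if_pos (Or.inl h1 : _ ∨ ∀ e ∈ edgesIn S, edgeSign C e = -1)]
  · by_cases h2 : ∀ e ∈ edgesIn S, edgeSign C e = -1
    · rw [if_pos (Or.inr h2), if_neg h1, if_pos h2]
      ring
    · rw [if_neg (not_or.2 ⟨h1, h2⟩), if_neg h1, if_neg h2]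
      ring

lemma subset_edgesIn_iff {G : Finset (Sym2 (Fin n))} (hG : ∀ e ∈ G, ¬ e.IsDiag)
    {S : Finset (Fin n)} : G ⊆ edgesIn S ↔ vertexSupport G ⊆ S := by
  constructor
  · intro h x hx
    obtain ⟨e, he, hxe⟩ := mem_vertexSupport.1 hx
    have := h he
    simp only [edgesIn, Finset.mem_image, Finset.mem_offDiag, Prod.exists] at this
    obtain ⟨a, b, ⟨ha, hb, -⟩, rfl⟩ := this
    rcases Sym2.mem_iff.1 hxe with rfl | rfl <;> assumption
  · intro h e he
    induction e with
    | _ x y =>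
      refine Finset.mem_image.2 ⟨(x, y), Finset.mem_offDiag.2 ⟨h ?_, h ?_, ?_⟩, rfl⟩
      · exact mem_vertexSupport.2 ⟨_, he, by simp⟩
      · exact mem_vertexSupport.2 ⟨_, he, by simp⟩
      · simpa using hG _ he

lemma not_isDiag_of_mem_edgesIn {S : Finset (Fin n)} {e : Sym2 (Fin n)} (he : e ∈ edgesIn S) :
    ¬ e.IsDiag := by
  revert e
  rw [forall_mem_edgesIn]
  intro x _ y _ h
  simpa using h

open Classical in
/-- The expansion of the indicator of a monochromatic set in characters. -/
lemma indicator_isMonochromatic (C : TwoColouring n) {S : Finset (Fin n)} (hS : 2 ≤ S.card) :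
    (if IsMonochromatic C S then (1 : ℝ) else 0) = 2 / 2 ^ S.card.choose 2 *
      (1 + ∑ G : Finset (Sym2 (Fin n)) with IsEvenEdgeSet G,
        if vertexSupport G ⊆ S then character C G else 0) := by
  have h := indicator_isMonochromatic_mul C hS
  -- Swapping the colours multiplies the character of `G` by `(-1) ^ G.card`, hence only even sets
  -- survive.
  have h1 : ∀ G ∈ (edgesIn S).powerset, character C G + ∏ e ∈ G, -edgeSign C e =
      if Even G.card then 2 * character C G else 0 := by
    intro G _
    rw [Finset.prod_neg, ← character]
    split_ifs with hG
    · rw [hG.neg_one_pow]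
      ring
    · rw [(Nat.not_even_iff_odd.1 hG).neg_one_pow]
      ring
  have hE : (edgesIn S).powerset.filter (fun G => Even G.card) =
      insert ∅ ((Finset.univ.filter fun G => IsEvenEdgeSet G).filter
        fun G => vertexSupport G ⊆ S) := by
    ext G
    simp only [Finset.mem_filter, Finset.mem_powerset, Finset.mem_insert, Finset.mem_univ,
      true_and]
    constructor
    · rintro ⟨hs, he⟩
      rcases G.eq_empty_or_nonempty with rfl | hne
      · exact Or.inl rfl
      · have hd : ∀ e ∈ G, ¬ e.IsDiag := fun e he => not_isDiag_of_mem_edgesIn (hs he)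
        exact Or.inr ⟨⟨hd, hne, he⟩, (subset_edgesIn_iff hd).1 hs⟩
    · rintro (rfl | ⟨hG, hs⟩)
      · simp
      · exact ⟨(subset_edgesIn_iff hG.not_isDiag).2 hs, hG.even_card⟩
  rw [Finset.prod_one_add, Finset.prod_one_add, ← Finset.sum_add_distrib] at h
  change _ = ∑ G ∈ (edgesIn S).powerset, (character C G + ∏ e ∈ G, -edgeSign C e) at h
  rw [Finset.sum_congr rfl h1, ← Finset.sum_filter, ← Finset.mul_sum, hE,
    Finset.sum_insert (by
      simp only [Finset.mem_filter, Finset.mem_univ, true_and, not_and]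
      exact fun h => (Finset.not_nonempty_empty h.nonempty).elim)] at h
  rw [← Finset.sum_filter]
  have hpos : (2 : ℝ) ^ S.card.choose 2 ≠ 0 := by positivity
  rw [div_mul_eq_mul_div, eq_div_iff hpos, h]
  simp [character]

lemma card_powersetCard_filter_superset (k : ℕ) (T : Finset (Fin n)) :
    (((Finset.powersetCard k (Finset.univ : Finset (Fin n))).filter fun S => T ⊆ S).card : ℝ) =
      cliqueWeight k n T.card := by
  rw [cliqueWeight]
  split_ifs with hk
  · have h : (Finset.powersetCard k (Finset.univ : Finset (Fin n))).filter (fun S => T ⊆ S) =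
        (Finset.powersetCard (k - T.card) Tᶜ).image (fun S => T ∪ S) := by
      ext S
      simp only [Finset.mem_filter, Finset.mem_powersetCard, Finset.subset_univ, true_and,
        Finset.mem_image]
      constructor
      · rintro ⟨hc, hs⟩
        refine ⟨S \ T, ⟨?_, ?_⟩, Finset.union_sdiff_of_subset hs⟩
        · intro x hx
          simp at hx ⊢
          exact hx.2
        · rw [Finset.card_sdiff_of_subset hs, hc]
      · rintro ⟨R, ⟨hR, hc⟩, rfl⟩
        refine ⟨?_, Finset.subset_union_left⟩
        rw [Finset.card_union_of_disjoint, hc]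
        · omega
        · exact Finset.disjoint_right.2 fun x hx => by simpa using hR hx
    rw [h, Finset.card_image_of_injOn, Finset.card_powersetCard, Finset.card_compl,
      Fintype.card_fin]
    intro R hR R' hR' heq
    have hd : ∀ R ∈ (Finset.powersetCard (k - T.card) Tᶜ : Set (Finset (Fin n))),
        (T ∪ R) \ T = R := by
      intro R hR
      have := (Finset.mem_powersetCard.1 (Finset.mem_coe.1 hR)).1
      rw [Finset.union_sdiff_left]
      exact Finset.sdiff_eq_self_of_disjoint
        (Finset.disjoint_left.2 fun x hx => by simpa using this hx)
    rw [← hd R hR, ← hd R' hR']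
    exact congrArg (· \ T) heq
  · rw [Finset.filter_false_of_mem, Finset.card_empty, Nat.cast_zero]
    intro S hS hTS
    have := Finset.card_le_card hTS
    rw [(Finset.mem_powersetCard.1 hS).2] at this
    exact hk this

open Classical in
/-- The expansion of the number of monochromatic cliques in characters. -/
lemma monoCliqueCount_eq {k : ℕ} (hk : 2 ≤ k) (C : TwoColouring n) :
    monoCliqueCount k n C = 2 / 2 ^ k.choose 2 * (n.choose k +
      ∑ G : Finset (Sym2 (Fin n)) with IsEvenEdgeSet G,
        cliqueWeight k n (vertexSupport G).card * character C G) := by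
  have h1 : ∀ S ∈ Finset.powersetCard k (Finset.univ : Finset (Fin n)),
      (if IsMonochromatic C S then (1 : ℝ) else 0) = 2 / 2 ^ k.choose 2 *
      (1 + ∑ G : Finset (Sym2 (Fin n)) with IsEvenEdgeSet G,
        if vertexSupport G ⊆ S then character C G else 0) := by
    intro S hS
    have hc := (Finset.mem_powersetCard.1 hS).2
    rw [indicator_isMonochromatic C (by omega), hc]
  rw [monoCliqueCount, Finset.sum_congr rfl h1, ← Finset.mul_sum, Finset.sum_add_distrib,
    Finset.sum_comm]
  congr 2
  · simp
  · refine Finset.sum_congr rfl fun G _ => ?_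
    rw [← card_powersetCard_filter_superset, ← Finset.sum_filter, Finset.sum_const, nsmul_eq_mul]

lemma sum_character {G : Finset (Sym2 (Fin n))} (hG : IsEvenEdgeSet G) :
    ∑ C : TwoColouring n, character C G = 0 := by
  classical
  have h := sum_prod_character (ι := Unit) (F := fun _ => G) fun _ => hG
  rw [if_neg] at h
  · simpa using h
  · intro hE
    obtain ⟨e, he⟩ := hG.nonempty
    obtain ⟨j, hj, -⟩ := hE.exists_ne_mem (i := ()) he
    exact hj rfl

lemma integral_monoCliqueCount {k : ℕ} (hk : 2 ≤ k) :
    ∫ C, monoCliqueCount k n C ∂(uniformColouring n) = 2 / 2 ^ k.choose 2 * n.choose k := by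
  classical
  have hcard : (Fintype.card (TwoColouring n) : ℝ) ≠ 0 :=
    Nat.cast_ne_zero.2 Fintype.card_ne_zero
  rw [integral_uniformColouring, Finset.sum_congr rfl fun C _ => monoCliqueCount_eq hk C,
    ← Finset.mul_sum, Finset.sum_add_distrib, Finset.sum_comm]
  rw [Finset.sum_eq_zero (s := Finset.univ.filter _)]
  · rw [Finset.sum_const, Finset.card_univ, nsmul_eq_mul, add_zero]
    field_simp
  · intro G hG
    rw [← Finset.mul_sum, sum_character (Finset.mem_filter.1 hG).2, mul_zero]

/-- The sum over even covers by `m` even edge sets of the numbers of ways to extend their supports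
to `k`-sets, each cover being counted with a coefficient. -/
noncomputable def coverSum (k m n : ℕ) (c : (Fin m → Finset (Sym2 (Fin n))) → ℝ) : ℝ :=
  open Classical in
  ∑ F : Fin m → Finset (Sym2 (Fin n)),
    (if EvenCover F ∧ ∀ i, IsEvenEdgeSet (F i) then c F else 0) *
      ∏ i, cliqueWeight k n (vertexSupport (F i)).card

/-- The central moments count even covers. -/
theorem monoCentralMoment_eq {k : ℕ} (hk : 2 ≤ k) (m n : ℕ) :
    monoCentralMoment k m n = (2 / 2 ^ k.choose 2) ^ m * coverSum k m n fun _ => 1 := by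
  classical
  have hcard : (Fintype.card (TwoColouring n) : ℝ) ≠ 0 :=
    Nat.cast_ne_zero.2 Fintype.card_ne_zero
  rw [monoCentralMoment, centralMoment, integral_monoCliqueCount hk]
  simp only [Pi.pow_apply, Pi.sub_apply]
  rw [integral_uniformColouring, div_eq_iff hcard]
  have h1 : ∀ C : TwoColouring n,
      (monoCliqueCount k n C - 2 / 2 ^ k.choose 2 * n.choose k) ^ m =
      (2 / 2 ^ k.choose 2) ^ m * ∑ F : Fin m → Finset (Sym2 (Fin n)),
        ((if ∀ i, IsEvenEdgeSet (F i) then 1 else 0) *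
          ∏ i, cliqueWeight k n (vertexSupport (F i)).card) * ∏ i, character C (F i) := by
    intro C
    rw [monoCliqueCount_eq hk, mul_add, add_sub_cancel_left, mul_pow, Finset.sum_filter,
      Fintype.sum_pow]
    congr 1
    refine Finset.sum_congr rfl fun F _ => ?_
    split_ifs with hF
    · rw [one_mul, ← Finset.prod_mul_distrib]
      exact Finset.prod_congr rfl fun i _ => if_pos (hF i)
    · push Not at hF
      obtain ⟨i, hi⟩ := hF
      rw [Finset.prod_eq_zero (Finset.mem_univ i) (if_neg hi)]
      ring
  rw [Finset.sum_congr rfl fun C _ => h1 C, ← Finset.mul_sum, Finset.sum_comm, mul_assoc, coverSum,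
    Finset.sum_mul]
  congr 1
  refine Finset.sum_congr rfl fun F _ => ?_
  rw [← Finset.mul_sum]
  by_cases hF : ∀ i, IsEvenEdgeSet (F i)
  · rw [sum_prod_character hF, if_pos hF]
    by_cases hE : EvenCover F
    · rw [if_pos hE, if_pos ⟨hE, hF⟩]
    · rw [if_neg hE, if_neg fun h => hE h.1]
      ring
  · rw [if_neg hF, if_neg fun h => hF h.2]
    ring

end Expectation

/-! ### Arithmetic of leading terms. -/

section LeadingTerms

open Polynomial

lemma HasLeadingTerm.mul {f g : ℕ → ℝ} {a b : ℝ} {d e : ℕ} (hf : HasLeadingTerm f a d)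
    (hg : HasLeadingTerm g b e) (ha : a ≠ 0) (hb : b ≠ 0) :
    HasLeadingTerm (fun n => f n * g n) (a * b) (d + e) := by
  obtain ⟨P, hP, rfl, rfl⟩ := hf
  obtain ⟨Q, hQ, rfl, rfl⟩ := hg
  refine ⟨P * Q, fun n => by simp only [hP, hQ, eval_mul], ?_, leadingCoeff_mul P Q⟩
  exact natDegree_mul (leadingCoeff_ne_zero.1 ha) (leadingCoeff_ne_zero.1 hb)

lemma HasLeadingTerm.const_mul {f : ℕ → ℝ} {a : ℝ} {d : ℕ} (hf : HasLeadingTerm f a d) {r : ℝ}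
    (hr : r ≠ 0) : HasLeadingTerm (fun n => r * f n) (r * a) d := by
  obtain ⟨P, hP, rfl, rfl⟩ := hf
  exact ⟨C r * P, fun n => by simp only [hP, eval_mul, eval_C], natDegree_C_mul hr,
    by rw [leadingCoeff_mul, leadingCoeff_C]⟩

lemma HasLeadingTerm.pow {f : ℕ → ℝ} {a : ℝ} {d : ℕ} (hf : HasLeadingTerm f a d) (m : ℕ) :
    HasLeadingTerm (fun n => f n ^ m) (a ^ m) (m * d) := by
  obtain ⟨P, hP, rfl, rfl⟩ := hf
  exact ⟨P ^ m, fun n => by simp only [hP, eval_pow], natDegree_pow P m, leadingCoeff_pow P m⟩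

lemma HasLeadingTerm.add_of_lt {f g : ℕ → ℝ} {a : ℝ} {d e : ℕ} (hf : HasLeadingTerm f a d)
    (hg : ∃ Q : ℝ[X], Q.natDegree ≤ e ∧ ∀ n : ℕ, g n = Q.eval (n : ℝ)) (he : e < d) :
    HasLeadingTerm (fun n => f n + g n) a d := by
  obtain ⟨P, hP, rfl, rfl⟩ := hf
  obtain ⟨Q, hQd, hQ⟩ := hg
  have hlt : Q.natDegree < P.natDegree := hQd.trans_lt he
  exact ⟨P + Q, fun n => by simp only [hP, hQ, eval_add], natDegree_add_eq_left_of_natDegree_lt hlt,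
    leadingCoeff_add_of_degree_lt' (degree_lt_degree hlt)⟩

/-- The leading term of the number of extensions of a family of `m` triples, for a number of
families proportional to `n.choose v`. -/
lemma hasLeadingTerm_choose_mul_cliqueWeight {k v : ℕ} (hk : 3 ≤ k) (hv : 3 ≤ v) (m : ℕ) :
    HasLeadingTerm (fun n => (n.choose v : ℝ) * cliqueWeight k n 3 ^ m)
      (1 / v.factorial * (1 / (k - 3).factorial) ^ m) (v + m * (k - 3)) := by
  refine ⟨chooseSubPoly v 0 * chooseSubPoly (k - 3) 3 ^ m, fun n => ?_, ?_, ?_⟩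
  · dsimp only
    rw [eval_mul, eval_pow, chooseSubPoly_eval (Nat.zero_le n), Nat.sub_zero]
    rcases lt_or_ge n v with hlt | hle
    · rw [Nat.choose_eq_zero_of_lt hlt, Nat.cast_zero, zero_mul, zero_mul]
    · rw [chooseSubPoly_eval (hv.trans hle), cliqueWeight, if_pos hk]
  · have h : ∀ j v, chooseSubPoly j v ≠ 0 := by
      intro j v
      rw [← leadingCoeff_ne_zero, chooseSubPoly_leadingCoeff]
      positivity
    rw [natDegree_mul (h _ _) (pow_ne_zero _ (h _ _)), natDegree_pow, chooseSubPoly_natDegree,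
      chooseSubPoly_natDegree]
  · rw [leadingCoeff_mul, leadingCoeff_pow, chooseSubPoly_leadingCoeff,
      chooseSubPoly_leadingCoeff]

end LeadingTerms

/-! ### Counting extremal covers and factoring out equal pairs. -/

section CoverSums

open Polynomial

variable {m k n : ℕ}

lemma coverSum_add (c c' : (Fin m → Finset (Sym2 (Fin n))) → ℝ) :
    coverSum k m n (fun F => c F + c' F) = coverSum k m n c + coverSum k m n c' := by
  rw [coverSum, coverSum, coverSum, ← Finset.sum_add_distrib]
  refine Finset.sum_congr rfl fun F _ => ?_
  split_ifs <;> ring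

lemma coverSum_sum {α : Type*} (s : Finset α) (c : α → (Fin m → Finset (Sym2 (Fin n))) → ℝ) :
    coverSum k m n (fun F => ∑ x ∈ s, c x F) = ∑ x ∈ s, coverSum k m n (c x) := by
  simp only [coverSum]
  rw [Finset.sum_comm]
  refine Finset.sum_congr rfl fun F _ => ?_
  split_ifs
  · rw [Finset.sum_mul]
  · simp

/-- Coefficients that vanish on the covers of large support give a polynomial of small degree. -/
lemma exists_polynomial_coverSum {r D : ℕ} (c : ∀ n, (Fin m → Finset (Sym2 (Fin n))) → ℝ)
    (hinv : ∀ {u n : ℕ} (f : Fin u ↪ Fin n) (F : Fin m → Finset (Sym2 (Fin u))),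
      c n (relabel f F) = c u F)
    (hzero : ∀ (u : ℕ) (F : Fin m → Finset (Sym2 (Fin u))), EvenCover F →
      (∀ i, IsEvenEdgeSet (F i)) →
      ∑ i, (vertexSupport (F i)).card ≤ (unionSupport F).card + r → c u F = 0)
    (hD : m * k ≤ D + r + 1) :
    ∃ P : ℝ[X], P.natDegree ≤ D ∧ ∀ n : ℕ, coverSum k m n (c n) = P.eval (n : ℝ) := by
  classical
  refine exists_polynomial_sum_cliqueWeight
    (fun n F => if EvenCover F ∧ ∀ i, IsEvenEdgeSet (F i) then c n F else 0) ?_ ?_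
  · intro u n f F
    simp only [evenCover_relabel_iff, hinv]
    congr 2
    exact forall_congr fun i => propext (isEvenEdgeSet_map_iff f)
  · intro u F hF hk
    have hE : EvenCover F ∧ ∀ i, IsEvenEdgeSet (F i) := by
      by_contra hn
      exact hF (if_neg hn)
    rw [if_pos hE] at hF
    have h1 : ¬ _ := fun h => hF (hzero u F hE.1 hE.2 h)
    have h2 : ∑ i, (k - (vertexSupport (F i)).card) + ∑ i, (vertexSupport (F i)).card = m * k := by
      rw [← Finset.sum_add_distrib, Finset.sum_congr rfl fun i _ => Nat.sub_add_cancel (hk i)]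
      simp
    omega

open Classical in
-- If all supports are triples, the product of weights is constant and only a count remains.
lemma coverSum_eq_card_mul {Q : (Fin m → Finset (Sym2 (Fin n))) → Prop} [DecidablePred Q]
    (hQ : ∀ F, EvenCover F ∧ (∀ i, IsEvenEdgeSet (F i)) → Q F →
      ∀ i, (vertexSupport (F i)).card = 3) :
    coverSum k m n (fun F => if Q F then 1 else 0) =
      (Finset.univ.filter fun F : Fin m → Finset (Sym2 (Fin n)) =>
        (EvenCover F ∧ ∀ i, IsEvenEdgeSet (F i)) ∧ Q F).card * cliqueWeight k n 3 ^ m := by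
  rw [coverSum, ← nsmul_eq_mul, ← Finset.sum_const, Finset.sum_filter]
  refine Finset.sum_congr rfl fun F _ => ?_
  by_cases h1 : EvenCover F ∧ ∀ i, IsEvenEdgeSet (F i)
  · by_cases h2 : Q F
    · rw [if_pos h1, if_pos h2, if_pos ⟨h1, h2⟩, one_mul,
        Finset.prod_congr rfl fun i _ => by rw [hQ F h1 h2 i]]
      simp
    · rw [if_pos h1, if_neg h2, if_neg fun h => h2 h.2, zero_mul]
  · rw [if_neg h1, if_neg fun h => h1 h.1, zero_mul]

open Classical in
/-- The number of pairs of equal two-edge paths. -/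
lemma card_fin_two_covers (n : ℕ) :
    (Finset.univ.filter fun F : Fin 2 → Finset (Sym2 (Fin n)) =>
      (EvenCover F ∧ ∀ i, IsEvenEdgeSet (F i)) ∧ (vertexSupport (F 0)).card = 3).card =
      3 * n.choose 3 := by
  have hcard : ((Finset.univ : Finset (Fin n)).sigma
      fun w => Finset.powersetCard 2 (Finset.univ.erase w)).card = 3 * n.choose 3 := by
    rw [Finset.card_sigma]
    simp only [Finset.card_powersetCard, Finset.card_erase_of_mem (Finset.mem_univ _),
      Finset.card_univ, Fintype.card_fin, Finset.sum_const, smul_eq_mul]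
    cases n with
    | zero => simp
    | succ n => rw [Nat.add_sub_cancel, Nat.add_one_mul_choose_eq, mul_comm]
  rw [← hcard]
  symm
  have hinj : ∀ w : Fin n, Function.Injective fun x => s(w, x) :=
    fun w x y h => Sym2.congr_right.1 h
  refine Finset.card_bij (fun p _ => fun _ => p.2.image fun x => s(p.1, x)) ?_ ?_ ?_
  · rintro ⟨w, t⟩ h
    simp only [Finset.mem_sigma, Finset.mem_univ, true_and, Finset.mem_powersetCard] at h
    obtain ⟨a, b, hab, rfl⟩ := Finset.card_eq_two.1 h.2
    have hwa : w ≠ a := fun h' => by simpa [h'] using h.1 (Finset.mem_insert_self a {b})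
    have hwb : w ≠ b := fun h' => by
      simpa [h'] using h.1 (Finset.mem_insert_of_mem (Finset.mem_singleton_self b))
    simp only [Finset.mem_filter, Finset.mem_univ, true_and, Finset.image_insert,
      Finset.image_singleton]
    exact ⟨⟨evenCover_fin_two_iff.2 rfl, fun _ => isEvenEdgeSet_path hwa hwb hab⟩,
      card_vertexSupport_path hwa hwb hab⟩
  · rintro ⟨w, t⟩ h ⟨w', t'⟩ h' heq
    have heq := congrFun heq 0
    simp only [Finset.mem_sigma, Finset.mem_univ, true_and, Finset.mem_powersetCard] at h h' heq
    -- With two different centres every edge of the path would contain both, leaving a single edge.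
    obtain rfl : w = w' := by
      by_contra hne
      have hall : ∀ e ∈ t.image fun x => s(w, x), e = s(w, w') := by
        intro e he
        refine (Sym2.mem_and_mem_iff hne).1 ⟨?_, ?_⟩
        · obtain ⟨x, -, rfl⟩ := Finset.mem_image.1 he
          simp
        · rw [heq] at he
          obtain ⟨x, -, rfl⟩ := Finset.mem_image.1 he
          simp
      have h1 := Finset.card_le_one.2 fun a ha b hb => (hall a ha).trans (hall b hb).symm
      rw [Finset.card_image_of_injective _ (hinj w), h.2] at h1
      omega
    rw [Finset.image_injective (hinj w) heq]
  · intro F hF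
    simp only [Finset.mem_filter, Finset.mem_univ, true_and] at hF
    obtain ⟨w, a, b, hwa, hwb, hab, hp⟩ := (hF.1.2 0).exists_eq_path hF.2
    refine ⟨⟨w, {a, b}⟩, ?_, ?_⟩
    · simp only [Finset.mem_sigma, Finset.mem_univ, true_and, Finset.mem_powersetCard]
      refine ⟨?_, Finset.card_pair hab⟩
      intro x hx
      simp only [Finset.mem_insert, Finset.mem_singleton] at hx
      rcases hx with rfl | rfl
      · simpa using hwa.symm
      · simpa using hwb.symm
    · funext i
      simp only [Finset.image_insert, Finset.image_singleton]
      rw [← hp]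
      match i with
      | 0 => rfl
      | 1 => exact hF.1.1.fin_two_eq

open Classical in
/-- The number of star covers. -/
lemma card_isStarCover (n : ℕ) :
    (Finset.univ.filter fun F : Fin 3 → Finset (Sym2 (Fin n)) => IsStarCover F).card =
      24 * n.choose 4 := by
  have hcard : Fintype.card (Fin 4 ↪ Fin n) = 24 * n.choose 4 := by
    rw [Fintype.card_embedding_eq, Fintype.card_fin, Fintype.card_fin,
      Nat.descFactorial_eq_factorial_mul_choose]
    rfl
  rw [← hcard, ← Finset.card_univ]
  symm
  refine Finset.card_bij (fun f _ => ![{s(f 0, f 1), s(f 0, f 2)}, {s(f 0, f 2), s(f 0, f 3)},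
    {s(f 0, f 1), s(f 0, f 3)}]) ?_ ?_ ?_
  · intro f _
    simp only [Finset.mem_filter, Finset.mem_univ, true_and]
    have hf : ∀ i j : Fin 4, i ≠ j → f i ≠ f j := fun i j h => f.injective.ne h
    exact ⟨f 0, f 1, f 2, f 3, hf _ _ (by decide), hf _ _ (by decide), hf _ _ (by decide),
      hf _ _ (by decide), hf _ _ (by decide), hf _ _ (by decide), rfl, rfl, rfl⟩
  · intro f _ g _ h
    have h0 : ({s(f 0, f 1), s(f 0, f 2)} : Finset (Sym2 (Fin n))) = {s(g 0, g 1), s(g 0, g 2)} :=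
      congrFun h 0
    have h1 : ({s(f 0, f 2), s(f 0, f 3)} : Finset (Sym2 (Fin n))) = {s(g 0, g 2), s(g 0, g 3)} :=
      congrFun h 1
    have h2 : ({s(f 0, f 1), s(f 0, f 3)} : Finset (Sym2 (Fin n))) = {s(g 0, g 1), s(g 0, g 3)} :=
      congrFun h 2
    have hg : ∀ i j : Fin 4, i ≠ j → s(g 0, g i) ≠ s(g 0, g j) :=
      fun i j hij h => hij (g.injective (Sym2.congr_right.1 h))
    have hg12 := hg 1 2 (by decide)
    have hg13 := hg 1 3 (by decide)
    have hg23 := hg 2 3 (by decide)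
    have e01 : s(f 0, f 1) ∈ ({s(f 0, f 1), s(f 0, f 2)} : Finset _) := by simp
    have e02 : s(f 0, f 2) ∈ ({s(f 0, f 1), s(f 0, f 2)} : Finset _) := by simp
    have e12 : s(f 0, f 2) ∈ ({s(f 0, f 2), s(f 0, f 3)} : Finset _) := by simp
    have e13 : s(f 0, f 3) ∈ ({s(f 0, f 2), s(f 0, f 3)} : Finset _) := by simp
    have e21 : s(f 0, f 1) ∈ ({s(f 0, f 1), s(f 0, f 3)} : Finset _) := by simp
    have e23 : s(f 0, f 3) ∈ ({s(f 0, f 1), s(f 0, f 3)} : Finset _) := by simp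
    rw [h0, Finset.mem_insert, Finset.mem_singleton] at e01 e02
    rw [h1, Finset.mem_insert, Finset.mem_singleton] at e12 e13
    rw [h2, Finset.mem_insert, Finset.mem_singleton] at e21 e23
    -- Each ray of the star is the unique common edge of two of the three paths, so the ordered
    -- triple of paths determines the labels of the leaves.
    have r1 : s(f 0, f 1) = s(g 0, g 1) := by
      rcases e01 with h | h
      · exact h
      · rcases e21 with h' | h'
        · exact h'
        · exact absurd (h.symm.trans h') hg23
    have r2 : s(f 0, f 2) = s(g 0, g 2) := by
      rcases e12 with h | h
      · exact h
      · rcases e02 with h' | h'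
        · exact absurd (h'.symm.trans h) hg13
        · exact h'
    have r3 : s(f 0, f 3) = s(g 0, g 3) := by
      rcases e13 with h | h
      · rcases e23 with h' | h'
        · exact absurd (h'.symm.trans h) hg12
        · exact h'
      · exact h
    have r0 : f 0 = g 0 := by
      by_contra hne
      have m1 : s(f 0, f 1) = s(f 0, g 0) :=
        (Sym2.mem_and_mem_iff hne).1 ⟨by simp, by rw [r1]; simp⟩
      have m2 : s(f 0, f 2) = s(f 0, g 0) :=
        (Sym2.mem_and_mem_iff hne).1 ⟨by simp, by rw [r2]; simp⟩
      have := f.injective (Sym2.congr_right.1 (m1.trans m2.symm))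
      exact absurd this (by decide)
    rw [r0] at r1 r2 r3
    ext i : 1
    match i with
    | 0 => exact r0
    | 1 => exact Sym2.congr_right.1 r1
    | 2 => exact Sym2.congr_right.1 r2
    | 3 => exact Sym2.congr_right.1 r3
  · intro F hF
    obtain ⟨w, a, b, c, hwa, hwb, hwc, hab, hac, hbc, h0, h1, h2⟩ := (Finset.mem_filter.1 hF).2
    refine ⟨⟨![w, a, b, c], ?_⟩, Finset.mem_univ _, ?_⟩
    · intro i j hij
      fin_cases i <;> fin_cases j <;> simp_all
    · funext i
      match i with
      | 0 => exact h0.symm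
      | 1 => exact h1.symm
      | 2 => exact h2.symm

lemma evenCover_comp_equiv {V ι κ : Type*} [DecidableEq V] [Fintype ι] [Fintype κ]
    {F : ι → Finset (Sym2 V)} (ρ : κ ≃ ι) : EvenCover (F ∘ ρ) ↔ EvenCover F := by
  refine forall_congr' fun e => ?_
  rw [Finset.card_filter, Finset.card_filter, ← Equiv.sum_comp ρ]
  rfl

/-- An equal pair covers every edge 0 or 2 times, so removing it does not affect parity. -/
lemma evenCover_sumElim_iff {V κ : Type*} [DecidableEq V] [Fintype κ]
    {A : Fin 2 → Finset (Sym2 V)} {B : κ → Finset (Sym2 V)} :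
    EvenCover (Sum.elim A B) ∧ A 0 = A 1 ↔ EvenCover A ∧ EvenCover B := by
  rw [and_comm, ← evenCover_fin_two_iff]
  refine and_congr_right fun hA => forall_congr' fun e => ?_
  have := hA e
  rw [Finset.card_filter] at this
  rw [Finset.card_filter, Fintype.sum_sum_type, Nat.even_add, Finset.card_filter fun i => e ∈ B i]
  exact ⟨fun h => h.1 this, fun h => ⟨fun _ => h, fun _ => this⟩⟩

lemma exists_equiv_fin {r : ℕ} {i j : Fin (r + 2)} (hij : i ≠ j) :
    ∃ ρ : Fin 2 ⊕ Fin r ≃ Fin (r + 2), ρ (Sum.inl 0) = i ∧ ρ (Sum.inl 1) = j := by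
  let ρ₀ : Fin 2 ⊕ Fin r ≃ Fin (r + 2) := Fintype.equivOfCardEq (by simp [add_comm])
  -- The first swap brings the image of `Sum.inl 0` to `i`; the second brings that of `Sum.inl 1` to
  -- `j` and fixes `i`.
  let σ : Equiv.Perm (Fin (r + 2)) := Equiv.swap (ρ₀ (Sum.inl 0)) i
  have hne : ρ₀ (Sum.inl 1) ≠ ρ₀ (Sum.inl 0) := ρ₀.injective.ne (by simp)
  have hσ : σ (ρ₀ (Sum.inl 1)) ≠ i := by
    rw [← Equiv.swap_apply_left (ρ₀ (Sum.inl 0)) i]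
    exact σ.injective.ne hne
  refine ⟨ρ₀.trans (σ.trans (Equiv.swap (σ (ρ₀ (Sum.inl 1))) j)), ?_, ?_⟩
  · simp only [Equiv.trans_apply]
    rw [show σ (ρ₀ (Sum.inl 0)) = i from Equiv.swap_apply_left _ _]
    exact Equiv.swap_apply_of_ne_of_ne hσ.symm hij
  · simp only [Equiv.trans_apply]
    exact Equiv.swap_apply_left _ _

open Classical in
/-- The covers in which two given sets coincide. -/
lemma coverSum_eq_pair {r : ℕ} {i j : Fin (r + 2)} (hij : i ≠ j) :
    coverSum k (r + 2) n (fun F => if F i = F j then 1 else 0) =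
      coverSum k 2 n (fun _ => 1) * coverSum k r n (fun _ => 1) := by
  obtain ⟨ρ, hi, hj⟩ := exists_equiv_fin hij
  rw [coverSum, coverSum, coverSum, Finset.sum_mul_sum, ← Fintype.sum_prod_type']
  symm
  refine Fintype.sum_equiv ((Equiv.sumArrowEquivProdArrow (Fin 2) (Fin r) _).symm.trans
    (Equiv.arrowCongr ρ (Equiv.refl _))) _ _ ?_
  rintro ⟨A, B⟩
  have hF : ((Equiv.sumArrowEquivProdArrow (Fin 2) (Fin r) _).symm.trans
    (Equiv.arrowCongr ρ (Equiv.refl _))) (A, B) = Sum.elim A B ∘ ρ.symm := rfl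
  rw [hF, evenCover_comp_equiv]
  have hi' : (Sum.elim A B ∘ ρ.symm) i = A 0 := by
    rw [← hi]
    simp
  have hj' : (Sum.elim A B ∘ ρ.symm) j = A 1 := by
    rw [← hj]
    simp
  have hgood : (∀ l, IsEvenEdgeSet ((Sum.elim A B ∘ ρ.symm) l)) ↔
      (∀ l, IsEvenEdgeSet (A l)) ∧ ∀ l, IsEvenEdgeSet (B l) := by
    refine ⟨fun h => ⟨fun l => ?_, fun l => ?_⟩, fun h l => ?_⟩
    · simpa using h (ρ (Sum.inl l))
    · simpa using h (ρ (Sum.inr l))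
    · obtain ⟨l | l, rfl⟩ := ρ.surjective l
      · simpa using h.1 l
      · simpa using h.2 l
  have hprod : ∏ l, cliqueWeight k n (vertexSupport ((Sum.elim A B ∘ ρ.symm) l)).card =
      (∏ l, cliqueWeight k n (vertexSupport (A l)).card) *
        ∏ l, cliqueWeight k n (vertexSupport (B l)).card := by
    exact (Equiv.prod_comp ρ.symm fun l =>
      cliqueWeight k n (vertexSupport (Sum.elim A B l)).card).trans (Fintype.prod_sum_type _)
  simp only [hi', hj', hprod, hgood]
  have hiff : (EvenCover (Sum.elim A B) ∧ (∀ l, IsEvenEdgeSet (A l)) ∧ ∀ l, IsEvenEdgeSet (B l)) ∧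
      A 0 = A 1 ↔ (EvenCover A ∧ ∀ l, IsEvenEdgeSet (A l)) ∧
        (EvenCover B ∧ ∀ l, IsEvenEdgeSet (B l)) := by
    have := evenCover_sumElim_iff (A := A) (B := B)
    tauto
  rw [← ite_and, if_congr hiff rfl rfl]
  by_cases hA : EvenCover A ∧ ∀ l, IsEvenEdgeSet (A l)
  · by_cases hB : EvenCover B ∧ ∀ l, IsEvenEdgeSet (B l)
    · rw [if_pos hA, if_pos hB, if_pos ⟨hA, hB⟩]
      ring
    · rw [if_neg hB, if_neg fun h : _ ∧ EvenCover B ∧ _ => hB h.2]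
      ring
  · rw [if_neg hA, if_neg fun h : _ ∧ EvenCover B ∧ _ => hA h.1]
    ring

end CoverSums

/-! ### Leading terms of the second to fifth moments. -/

section Moments

open Polynomial

lemma two_div_two_pow_pow (c m : ℕ) (hc : 1 ≤ c) :
    ((2 : ℝ) / 2 ^ c) ^ m = 1 / 2 ^ (m * c - m) := by
  obtain ⟨c, rfl⟩ := Nat.exists_eq_add_of_le' hc
  rw [show m * (c + 1) - m = c * m by rw [mul_add, mul_one, Nat.add_sub_cancel, mul_comm], pow_mul,
    ← one_div_pow]
  congr 1
  rw [pow_succ]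
  field_simp

variable {k : ℕ}

/-- Scaling by the power of the density `2 ^ (1 - k.choose 2)` in a central moment. -/
lemma HasLeadingTerm.monoCentralMoment (hk : 3 ≤ k) {m d : ℕ} {a : ℝ}
    (h : HasLeadingTerm (fun n => coverSum k m n fun _ => 1) a d) :
    HasLeadingTerm (fun n => monoCentralMoment k m n) (a * (1 / 2 ^ (m * k.choose 2 - m))) d := by
  have hc : 1 ≤ k.choose 2 := Nat.choose_pos (by omega)
  have h1 := h.const_mul (r := (2 / 2 ^ k.choose 2) ^ m) (by positivity)
  rw [← two_div_two_pow_pow _ _ hc, mul_comm a]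
  simpa only [monoCentralMoment_eq (show 2 ≤ k by omega)] using h1

theorem hasLeadingTerm_coverSum_two (hk : 3 ≤ k) :
    HasLeadingTerm (fun n => coverSum k 2 n fun _ => 1)
      (1 / 2 * (1 / ((k - 3).factorial : ℝ) ^ 2)) (2 * k - 3) := by
  classical
  -- Here `r = 3` is the minimal excess and `D = 2 * k - r - 1`: all other covers lose at least one
  -- degree.
  have hlow := exists_polynomial_coverSum (m := 2) (k := k) (r := 3) (D := 2 * k - 4)
    (fun n F => if (vertexSupport (F 0)).card = 3 then 0 else 1)
    (fun f F => by simp only [card_vertexSupport_relabel])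
    (fun u F hE hF h => if_pos (by
      by_contra h3
      have := hE.fin_two_excess hF h3
      omega)) (by omega)
  have hmain := (hasLeadingTerm_choose_mul_cliqueWeight hk le_rfl 2).const_mul
    (r := 3) (by norm_num)
  have h := hmain.add_of_lt hlow (by omega)
  convert h using 1
  · funext n
    have h1 : coverSum k 2 n (fun F => if (vertexSupport (F 0)).card = 3 then 1 else 0) =
        3 * (n.choose 3 * cliqueWeight k n 3 ^ 2) := by
      rw [coverSum_eq_card_mul, card_fin_two_covers]
      · push_cast
        ring
      · intro F hF h3 i
        match i with
        | 0 => exact h3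
        | 1 => rwa [← hF.1.fin_two_eq]
    rw [← h1, ← coverSum_add]
    congr 1
    funext F
    split_ifs <;> simp
  · rw [show Nat.factorial 3 = 6 from rfl, one_div_pow]
    push_cast
    ring
  · omega

theorem hasLeadingTerm_coverSum_three (hk : 3 ≤ k) :
    HasLeadingTerm (fun n => coverSum k 3 n fun _ => 1)
      (1 / ((k - 3).factorial : ℝ) ^ 3) (3 * k - 5) := by
  classical
  have hlow := exists_polynomial_coverSum (m := 3) (k := k) (r := 5) (D := 3 * k - 6)
    (fun n F => if ∑ i, (vertexSupport (F i)).card ≤ (unionSupport F).card + 5 then 0 else 1)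
    (fun f F => by
      simp only [card_vertexSupport_relabel, unionSupport_relabel, Finset.card_map])
    (fun u F _ _ h => if_pos h) (by omega)
  have hmain := (hasLeadingTerm_choose_mul_cliqueWeight hk (show 3 ≤ 4 by omega) 3).const_mul
    (r := 24) (by norm_num)
  have h := hmain.add_of_lt hlow (by omega)
  convert h using 1
  · funext n
    have h1 : coverSum k 3 n (fun F =>
        if ∑ i, (vertexSupport (F i)).card ≤ (unionSupport F).card + 5 then 1 else 0) =
        24 * (n.choose 4 * cliqueWeight k n 3 ^ 3) := by
      rw [coverSum_eq_card_mul fun F h1 h2 => (isStarCover_iff.2 ⟨h1, h2⟩).card_vertexSupport]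
      simp only [← isStarCover_iff]
      rw [card_isStarCover]
      push_cast
      ring
    rw [← h1, ← coverSum_add]
    congr 1
    funext F
    split_ifs <;> simp
  · rw [show Nat.factorial 4 = 24 from rfl, one_div_pow]
    push_cast
    ring
  · omega

open Classical in
-- Counting the partners of index 0 weights each cover by a sum of pair conditions, each of which
-- factors by `coverSum_eq_pair`. By `EvenCover.fin_four_card_eq_one` the weight is 1 on extremal
-- covers, so the correction has lower degree.
lemma coverSum_four_eq (k n : ℕ) : coverSum k 4 n (fun _ => 1) =
    3 * (coverSum k 2 n fun _ => 1) ^ 2 + coverSum k 4 n fun F =>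
      1 - ((Finset.univ.filter fun j : Fin 4 => j ≠ 0 ∧ F 0 = F j).card : ℝ) := by
  have h1 : coverSum k 4 n (fun F =>
      ((Finset.univ.filter fun j : Fin 4 => j ≠ 0 ∧ F 0 = F j).card : ℝ)) =
      3 * (coverSum k 2 n fun _ => 1) ^ 2 := by
    have h2 : ∀ F : Fin 4 → Finset (Sym2 (Fin n)),
        ((Finset.univ.filter fun j : Fin 4 => j ≠ 0 ∧ F 0 = F j).card : ℝ) =
        ∑ j : Fin 4 with j ≠ 0, if F 0 = F j then 1 else 0 := by
      intro F
      rw [Finset.sum_boole, Finset.filter_filter]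
    simp only [h2]
    rw [coverSum_sum, Finset.sum_congr rfl fun j hj =>
      coverSum_eq_pair (r := 2) (Finset.mem_filter.1 hj).2.symm, Finset.sum_const,
      show (Finset.univ.filter fun j : Fin 4 => j ≠ 0).card = 3 by decide, nsmul_eq_mul, sq]
    norm_num
  rw [← h1, ← coverSum_add]
  simp

theorem hasLeadingTerm_coverSum_four (hk : 3 ≤ k) :
    HasLeadingTerm (fun n => coverSum k 4 n fun _ => 1)
      (3 / 4 * (1 / ((k - 3).factorial : ℝ) ^ 4)) (4 * k - 6) := by
  classical
  have hlow := exists_polynomial_coverSum (m := 4) (k := k) (r := 6) (D := 4 * k - 7)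
    (fun n F => 1 - ((Finset.univ.filter fun j : Fin 4 => j ≠ 0 ∧ F 0 = F j).card : ℝ))
    (fun f F => by simp only [relabel_apply_eq_iff])
    (fun u F hE hF h => by
      rw [hE.fin_four_card_eq_one hF h, Nat.cast_one, sub_self]) (by omega)
  have hmain := ((hasLeadingTerm_coverSum_two hk).pow 2).const_mul (r := 3) (by norm_num)
  have h := hmain.add_of_lt hlow (by omega)
  convert h using 1
  · exact funext fun n => coverSum_four_eq k n
  · ring
  · omega

open Classical in
-- No index need belong to the equal pair here, so all 10 unordered pairs are counted; the three
-- remaining sets contribute the cover sum for `m = 3`.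
lemma coverSum_five_eq (k n : ℕ) : coverSum k 5 n (fun _ => 1) =
    10 * ((coverSum k 2 n fun _ => 1) * coverSum k 3 n fun _ => 1) + coverSum k 5 n fun F =>
      1 - ((Finset.univ.filter fun p : Fin 5 × Fin 5 => p.1 < p.2 ∧ F p.1 = F p.2).card : ℝ) := by
  have h1 : coverSum k 5 n (fun F =>
      ((Finset.univ.filter fun p : Fin 5 × Fin 5 => p.1 < p.2 ∧ F p.1 = F p.2).card : ℝ)) =
      10 * ((coverSum k 2 n fun _ => 1) * coverSum k 3 n fun _ => 1) := by
    have h2 : ∀ F : Fin 5 → Finset (Sym2 (Fin n)),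
        ((Finset.univ.filter fun p : Fin 5 × Fin 5 => p.1 < p.2 ∧ F p.1 = F p.2).card : ℝ) =
        ∑ p : Fin 5 × Fin 5 with p.1 < p.2, if F p.1 = F p.2 then 1 else 0 := by
      intro F
      rw [Finset.sum_boole, Finset.filter_filter]
    simp only [h2]
    rw [coverSum_sum, Finset.sum_congr rfl fun p hp =>
      coverSum_eq_pair (r := 3) (Finset.mem_filter.1 hp).2.ne, Finset.sum_const,
      show (Finset.univ.filter fun p : Fin 5 × Fin 5 => p.1 < p.2).card = 10 by decide,
      nsmul_eq_mul]
    norm_num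
  rw [← h1, ← coverSum_add]
  simp

theorem hasLeadingTerm_coverSum_five (hk : 3 ≤ k) :
    HasLeadingTerm (fun n => coverSum k 5 n fun _ => 1)
      (5 * (1 / ((k - 3).factorial : ℝ) ^ 5)) (5 * k - 8) := by
  classical
  have hlow := exists_polynomial_coverSum (m := 5) (k := k) (r := 8) (D := 5 * k - 9)
    (fun n F =>
      1 - ((Finset.univ.filter fun p : Fin 5 × Fin 5 => p.1 < p.2 ∧ F p.1 = F p.2).card : ℝ))
    (fun f F => by simp only [relabel_apply_eq_iff])
    (fun u F hE hF h => by
      rw [hE.fin_five_card_eq_one hF h, Nat.cast_one, sub_self]) (by omega)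
  have hmain := ((hasLeadingTerm_coverSum_two hk).mul (hasLeadingTerm_coverSum_three hk)
    (by positivity) (by positivity)).const_mul (r := 10) (by norm_num)
  have h := hmain.add_of_lt hlow (by omega)
  convert h using 1
  · exact funext fun n => coverSum_five_eq k n
  · ring
  · omega

end Moments

theorem mainTheorem1 (k : ℕ) (hk : 3 ≤ k) :
    HasLeadingTerm (fun n => monoCentralMoment k 2 n)
      (1 / 2 * (1 / ((k - 3).factorial : ℝ) ^ 2) * (1 / 2 ^ (2 * k.choose 2 - 2))) (2 * k - 3) ∧
    HasLeadingTerm (fun n => monoCentralMoment k 3 n)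
      (1 / ((k - 3).factorial : ℝ) ^ 3 * (1 / 2 ^ (3 * k.choose 2 - 3))) (3 * k - 5) ∧
    HasLeadingTerm (fun n => monoCentralMoment k 4 n)
      (3 / 4 * (1 / ((k - 3).factorial : ℝ) ^ 4) * (1 / 2 ^ (4 * k.choose 2 - 4))) (4 * k - 6) ∧
    HasLeadingTerm (fun n => monoCentralMoment k 5 n)
      (5 * (1 / ((k - 3).factorial : ℝ) ^ 5) * (1 / 2 ^ (5 * k.choose 2 - 5))) (5 * k - 8) :=
  ⟨(hasLeadingTerm_coverSum_two hk).monoCentralMoment hk,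
    (hasLeadingTerm_coverSum_three hk).monoCentralMoment hk,
    (hasLeadingTerm_coverSum_four hk).monoCentralMoment hk,
    (hasLeadingTerm_coverSum_five hk).monoCentralMoment hk⟩
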